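/- Notation: $\langle y\rangle=\sqrt{1+|y|^2}$, $\hat v=v/\langle v\rangle$ for $v\in\mathbb R^3$, $\lambda_\pm(k)=\pm i\langle k\rangle$, $a_\pm(k)=\mp\frac{i}{2\langle k\rangle}$ for $k\in\mathbb R^3$. Let $G^{osc}_\pm(t,x)$ and $\phi_{\pm,1}(x,v)$ be the (distributional) kernels whose Fourier transforms in $x$ are $$\widehat G^{osc}_\pm(t,k)=e^{\lambda_\pm(k)t}a_\pm(k),\qquad \widehat\phi_{\pm,1}(k,v)=\frac{1}{\lambda_\pm(k)+ik\cdot\hat v},$$ so that $\star_x$ with such a kernel is the Fourier multiplier on $L^2(\mathbb R^3_x)$ with that symbol (Fourier convention $\hat u(k)=\int e^{-ik\cdot x}u(x)\,dx$); likewise $a_\pm(i\partial_x)$ is the multiplier with symbol $a_\pm(k)$. Put $G^{osc}_\pm\star_{t,x}F(t)=\int_0^t G^{osc}_\pm(t-\tau)\star_x F(\tau)\,d\tau$. Let $E:[0,T]\times\mathbb R^3\to\mathbb R^3$ be continuous, bounded, and Lipschitz in $x$ uniformly in $t$ (for instance the electric field of a sufficiently regular solution of the relativistic Vlasov-Klein-Gordon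 system). Let $(X_{s,t},V_{s,t})(x,v)$ be its characteristics: $\frac{d}{ds}X_{s,t}=\widehat V_{s,t}$, $\frac{d}{ds}V_{s,t}=E(s,X_{s,t})$, $X_{t,t}=x$, $V_{t,t}=v$. Let $f_0\in L^2(\mathbb R^3_x\times\mathbb R^3_v)$ be real-valued with $f_0(x,v)=0$ for $|v|>R$, for some $R$, and let $\varphi\in C^1(\mathbb R^3_v)$ be real-valued. Write $f(t,x,v)=f_0(X_{0,t}(x,v),V_{0,t}(x,v))$ and $$S(t,x)=\int f(t,x,v)\varphi(v)\,dv .$$ Then, for each choice of sign and all $t\in[0,T]$, all the terms below are well defined (the integrals in $v$ and in $\tau$ converge as integrals with values in $L^2(\mathbb R^3_x)$), and, in $L^2(\mathbb R^3_x)$, $$G^{osc}_\pm\star_{t,x}S(t)=G^{osc}_\pm(t)\star_x S_{\pm,0}-a_\pm(i\partial_x)S_{\pm,1}(t)+G^{osc}_\pm\star_{t,x}S_{\pm,2}(t),$$ where $$S_{\pm,0}(x)=\int\phi_{\pm,1}(\cdot,v)\star_x f_0(\cdot,v)\,\varphi(v)\,dv,\qquad S_{\pm,1}(t,x)=\int\phi_{\pm,1}(\cdot,v)\star_x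 f(t,\cdot,v)\,\varphi(v)\,dv,$$ $$S_{\pm,2}(t,x)=\int\nabla_v\big(\phi_{\pm,1}(\cdot,v)\varphi(v)\big)\star_x\cdot\big[E(t,\cdot)f(t,\cdot,v)\big]\,dv ,$$ the last one with the dot product of the two vectors. -/

import Mathlib

open MeasureTheory Set
open scoped FourierTransform NNReal ContDiff

noncomputable section

namespace VKG

/-- Physical space, velocity space and frequency space. -/
abbrev R3 := EuclideanSpace ℝ (Fin 3)

/-- Complex-valued square integrable functions of `x`. -/
abbrev L2x := Lp ℂ 2 (volume : Measure R3)

/-- The class in `L²` of a function of `x` (and `0` if the function is not in `L²`). -/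
def toL2 (h : R3 → ℂ) : L2x :=
  open Classical in if hh : MemLp h 2 (volume : Measure R3) then hh.toLp h else 0

/-- The Japanese bracket `⟨y⟩ = √(1 + |y|²)`. -/
def bracket (y : R3) : ℝ := Real.sqrt (1 + ‖y‖ ^ 2)

/-- The relativistic velocity `v / ⟨v⟩`. -/
def hatv (v : R3) : R3 := (bracket v)⁻¹ • v

/-- `λ_±(k) = ± i ⟨k⟩`; the sign is an element of `ℤˣ = {1, -1}`. -/
def lam (σ : ℤˣ) (k : R3) : ℂ := ((σ : ℤ) : ℂ) * Complex.I * (bracket k : ℂ)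

/-- `a_±(k) = ∓ (i / 2) ⟨k⟩⁻¹`. -/
def aSymb (σ : ℤˣ) (k : R3) : ℂ :=
  -((σ : ℤ) : ℂ) * (Complex.I / 2) * ((bracket k : ℂ))⁻¹

/-- The Fourier transform in `x` of the oscillatory kernel `G^osc_±(t, x)`:
`e^{λ_±(k) t} a_±(k)`. -/
def GSymb (σ : ℤˣ) (t : ℝ) (k : R3) : ℂ := Complex.exp (lam σ k * (t : ℂ)) * aSymb σ k

/-- The Fourier transform in `x` of the kernel `φ_{±,1}(x, v)`: `(λ_±(k) + i k · v̂)⁻¹`. -/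
def phiSymb (σ : ℤˣ) (v k : R3) : ℂ :=
  (lam σ k + Complex.I * ((inner ℝ k (hatv v) : ℝ) : ℂ))⁻¹

/-- The Fourier transform in `x` of the kernel `∂_{v_j} (φ_{±,1}(x, v) φ(v))`. -/
def gradPhiSymb (σ : ℤˣ) (φ : R3 → ℝ) (j : Fin 3) (v k : R3) : ℂ :=
  fderiv ℝ (fun w : R3 => phiSymb σ w k * ((φ w : ℝ) : ℂ)) v (EuclideanSpace.single j (1 : ℝ))

/-- Convolution in `x` with the (distributional) kernel whose Fourier transform is the bounded
function `m(k)`, that is, the Fourier multiplier with symbol `m`, acting on `L²`. Mathlib's Fourier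
transform uses `e^{-2πi x·ξ}`, so that the frequency of the text is `k = 2πξ`. -/
def kerConv (m : R3 → ℂ) (u : L2x) : L2x :=
  𝓕⁻ (toL2 fun ξ => m ((2 * Real.pi) • ξ) * (𝓕 u : L2x) ξ)

/-- The spacetime convolution `(G^osc_± ⋆_{t,x} F)(t) = ∫₀ᵗ G^osc_±(t - τ) ⋆_x F(τ) dτ`,
as an integral in `L²`. -/
def spacetimeConv (σ : ℤˣ) (F : ℝ → L2x) (t : ℝ) : L2x :=
  ∫ τ in (0 : ℝ)..t, kerConv (GSymb σ (t - τ)) (F τ)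

/-- `(X, V)` are the characteristics of the field `E` on the time interval `[0, T]`:
for all `t`, the curve `s ↦ (X s t x v, V s t x v)` solves `dX/ds = V̂`, `dV/ds = E(s, X)` and
passes through `(x, v)` at `s = t`. -/
structure IsCharacteristics (T : ℝ) (E : ℝ → R3 → R3) (X V : ℝ → ℝ → R3 → R3 → R3) : Prop where
  init_X : ∀ t ∈ Icc 0 T, ∀ x v, X t t x v = x
  init_V : ∀ t ∈ Icc 0 T, ∀ x v, V t t x v = v
  deriv_X : ∀ t ∈ Icc 0 T, ∀ x v, ∀ s ∈ Icc 0 T,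
    HasDerivWithinAt (fun r => X r t x v) (hatv (V s t x v)) (Icc 0 T) s
  deriv_V : ∀ t ∈ Icc 0 T, ∀ x v, ∀ s ∈ Icc 0 T,
    HasDerivWithinAt (fun r => V r t x v) (E s (X s t x v)) (Icc 0 T) s

/-- The particle density `f(t, x, v) = f₀(X_{0,t}(x, v), V_{0,t}(x, v))`. -/
def transported (f₀ : R3 → R3 → ℝ) (X V : ℝ → ℝ → R3 → R3 → R3) (t : ℝ) (x v : R3) : ℝ :=
  f₀ (X 0 t x v) (V 0 t x v)

/-- The source density `S(t, x) = ∫ f(t, x, v) φ(v) dv`, where `g = f(t)`. -/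
def source (φ : R3 → ℝ) (g : R3 → R3 → ℝ) (x : R3) : ℝ := ∫ v, g x v * φ v

/-- The integrand, as a function of `v` with values in `L²_x`, of `sourcePhi`. -/
def sourcePhiIntegrand (σ : ℤˣ) (φ : R3 → ℝ) (g : R3 → R3 → ℝ) (v : R3) : L2x :=
  (φ v : ℂ) • kerConv (phiSymb σ v) (toL2 fun x => (g x v : ℂ))

/-- `∫ φ_{±,1}(·, v) ⋆_x g(·, v) φ(v) dv`: this is `S_{±,0}` for `g = f₀` and
`S_{±,1}(t)` for `g = f(t)`. -/
def sourcePhi (σ : ℤˣ) (φ : R3 → ℝ) (g : R3 → R3 → ℝ) : L2x :=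
  ∫ v, sourcePhiIntegrand σ φ g v

/-- The integrand, as a function of `v` with values in `L²_x`, of `sourceQuad`. -/
def sourceQuadIntegrand (σ : ℤˣ) (φ : R3 → ℝ) (e : R3 → R3) (g : R3 → R3 → ℝ) (v : R3) : L2x :=
  ∑ j : Fin 3, kerConv (gradPhiSymb σ φ j v) (toL2 fun x => ((e x j * g x v : ℝ) : ℂ))

/-- `∫ ∇_v (φ_{±,1}(·, v) φ(v)) ⋆_x [e g(·, v)] dv`, with the dot product of the two vectors;
this is `S_{±,2}(t)` for `e = E(t)` and `g = f(t)`. -/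
def sourceQuad (σ : ℤˣ) (φ : R3 → ℝ) (e : R3 → R3) (g : R3 → R3 → ℝ) : L2x :=
  ∫ v, sourceQuadIntegrand σ φ e g v

end VKG

end

open VKG

/-!
The idea is to integrate by parts in time along the characteristics. With `k` the frequency, a
particle at `x = X(τ)` with velocity `v = V(τ)` contributes the oscillation
`e^{-i k·x} e^{λ_±(k)(t - τ)}` to the Fourier transform of the left-hand side at time `τ`. Its
derivative in `τ` brings down the factor `-(λ_±(k) + i k·v̂)`, which never vanishes because
`|v̂| < 1` (`le_norm_phase`). Hence the oscillation times `φ(v) / (λ_±(k) + i k·v̂)` has as its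
derivative minus the contribution to the left-hand side, plus a term in which the force `E` acts by
the velocity gradient of that quotient (`hasDerivAt_testIntegrand`). Integrated over `[0, t]`, the
end points give `S_{±,0}` and `S_{±,1}`, since `G^osc_±(0)` has symbol `a_±`, and the force term
gives `S_{±,2}`.

To make sense of this in `L²`, both sides are paired with continuous compactly supported functions
of the frequency, which separate points (`eq_of_fourierPairing_eq`). Paired with such a cut-off,
every term becomes an absolutely convergent integral over phase space
(`fourierPairing_kineticIntegral`): for bounded velocities all symbols are bounded, so that
Plancherel's theorem and the square integrability of the density give a majorant. The change of
variables along the flow (`fourierPairing_kerConv_eq_integral_fwd`) and Fubini's theorem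
(`fourierPairing_duhamel`) turn these integrals into integrals against the initial density of
quantities depending on one characteristic each, and there the identity is
`testField_sub_testField`.

The change of variables needs Liouville's theorem for a field that is only Lipschitz in `x`
(`measurePreserving_flow_zero`). It is proved by operator splitting: on a short time step the flow
agrees to first order with a drift followed by a kick, which preserve volume as shears, so the
integral of a Lipschitz test function along the flow has zero derivative in the initial time
(`integral_comp_flow_eq`). Liouville's theorem also shows that the initial density may be replaced
by a Borel measurable representative.
-/

namespace VKG

/-! ### The relativistic velocity -/

lemma one_le_bracket (y : R3) : 1 ≤ bracket y := by
  rw [bracket, Real.one_le_sqrt]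
  nlinarith [sq_nonneg ‖y‖]

lemma bracket_pos (y : R3) : 0 < bracket y := one_pos.trans_le (one_le_bracket y)

lemma bracket_sq (y : R3) : bracket y ^ 2 = 1 + ‖y‖ ^ 2 := Real.sq_sqrt (by positivity)

lemma norm_le_bracket (y : R3) : ‖y‖ ≤ bracket y :=
  Real.le_sqrt_of_sq_le (by linarith)

lemma contDiff_bracket {n : WithTop ℕ∞} : ContDiff ℝ n bracket :=
  (contDiff_const.add (contDiff_norm_sq ℝ)).sqrt fun y => by positivity

lemma contDiff_hatv {n : WithTop ℕ∞} : ContDiff ℝ n hatv :=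
  (contDiff_bracket.inv fun y => (bracket_pos y).ne').smul contDiff_id

lemma norm_hatv (v : R3) : ‖hatv v‖ = (bracket v)⁻¹ * ‖v‖ := by
  rw [hatv, norm_smul, Real.norm_of_nonneg (inv_nonneg.2 (bracket_pos v).le)]

lemma norm_hatv_le_one (v : R3) : ‖hatv v‖ ≤ 1 := by
  rw [norm_hatv, inv_mul_le_one₀ (bracket_pos v)]
  exact norm_le_bracket v

lemma abs_bracket_sub_le (v w : R3) : |bracket v - bracket w| ≤ ‖v - w‖ := by
  refine le_trans ?_ (abs_norm_sub_norm_le v w)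
  have h : (bracket v - bracket w) * (bracket v + bracket w)
      = (‖v‖ - ‖w‖) * (‖v‖ + ‖w‖) := by
    nlinarith [bracket_sq v, bracket_sq w]
  have hpos : 0 < bracket v + bracket w := add_pos (bracket_pos v) (bracket_pos w)
  have hle : ‖v‖ + ‖w‖ ≤ bracket v + bracket w :=
    add_le_add (norm_le_bracket v) (norm_le_bracket w)
  have h2 : |bracket v - bracket w| * (bracket v + bracket w)
      = |‖v‖ - ‖w‖| * (‖v‖ + ‖w‖) := by
    rw [← abs_of_pos hpos, ← abs_mul, h, abs_mul, abs_of_nonneg (by positivity : 0 ≤ ‖v‖ + ‖w‖)]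
  refine le_of_mul_le_mul_right ?_ hpos
  rw [h2]
  gcongr

lemma lipschitzWith_hatv : LipschitzWith 2 hatv := by
  refine LipschitzWith.of_dist_le_mul fun v w => ?_
  rw [dist_eq_norm, dist_eq_norm]
  have hv := bracket_pos v
  have hw := bracket_pos w
  have key : hatv v - hatv w
      = (bracket v)⁻¹ • (v - w) + ((bracket v)⁻¹ * (bracket w - bracket v)) • hatv w := by
    simp only [hatv, smul_smul, smul_sub]
    have : (bracket v)⁻¹ * (bracket w - bracket v) * (bracket w)⁻¹
        = (bracket v)⁻¹ - (bracket w)⁻¹ := by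
      field_simp
    rw [this, sub_smul]
    abel
  have hinv : (bracket v)⁻¹ ≤ 1 := inv_le_one_of_one_le₀ (one_le_bracket v)
  have hinv0 : 0 ≤ (bracket v)⁻¹ := inv_nonneg.2 hv.le
  rw [key]
  refine (norm_add_le _ _).trans ?_
  rw [norm_smul, norm_smul, norm_mul, Real.norm_of_nonneg hinv0, Real.norm_eq_abs]
  have h1 := abs_bracket_sub_le w v
  rw [norm_sub_rev] at h1
  have h2 : (bracket v)⁻¹ * |bracket w - bracket v| * ‖hatv w‖ ≤ 1 * ‖v - w‖ * 1 := by
    gcongr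
    exact norm_hatv_le_one w
  have h3 : (bracket v)⁻¹ * ‖v - w‖ ≤ 1 * ‖v - w‖ := by gcongr
  push_cast
  linarith

/-! ### Grönwall's estimate on a compact time interval -/

/-- Two solutions of an ordinary differential equation whose field is Lipschitz in space separate
at most exponentially, forwards and backwards in time. -/
lemma dist_le_exp_of_solutions {F : Type*} [NormedAddCommGroup F] [NormedSpace ℝ F]
    {T : ℝ} {L : ℝ≥0} {W : ℝ → F → F} (hW : ∀ t ∈ Icc 0 T, LipschitzWith L (W t))
    {γ₁ γ₂ : ℝ → F}
    (h₁ : ∀ t ∈ Icc 0 T, HasDerivWithinAt γ₁ (W t (γ₁ t)) (Icc 0 T) t)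
    (h₂ : ∀ t ∈ Icc 0 T, HasDerivWithinAt γ₂ (W t (γ₂ t)) (Icc 0 T) t)
    {a b : ℝ} (ha : a ∈ Icc 0 T) (hb : b ∈ Icc 0 T) :
    dist (γ₁ b) (γ₂ b) ≤ dist (γ₁ a) (γ₂ a) * Real.exp (L * T) := by
  have hL : (0 : ℝ) ≤ L := L.2
  rcases le_total a b with hab | hba
  · have hsub : Icc a b ⊆ Icc 0 T := Icc_subset_Icc ha.1 hb.2
    have hd : ∀ γ : ℝ → F, (∀ t ∈ Icc 0 T, HasDerivWithinAt γ (W t (γ t)) (Icc 0 T) t) →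
        ∀ t ∈ Ico a b, HasDerivWithinAt γ (W t (γ t)) (Ici t) t := by
      intro γ h t ht
      refine (h t (hsub (Ico_subset_Icc_self ht))).mono_of_mem_nhdsWithin ?_
      exact Filter.mem_of_superset (Icc_mem_nhdsGE ht.2)
        (Icc_subset_Icc (ha.1.trans ht.1) hb.2)
    have := dist_le_of_trajectories_ODE_of_mem (v := W) (s := fun _ => univ) (K := L)
      (f := γ₁) (g := γ₂) (a := a) (b := b) (δ := dist (γ₁ a) (γ₂ a))
      (fun t ht => (hW t (hsub (Ico_subset_Icc_self ht))).lipschitzOnWith)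
      (fun t ht => ((h₁ t (hsub ht)).continuousWithinAt).mono hsub) (hd γ₁ h₁)
      (fun _ _ => trivial)
      (fun t ht => ((h₂ t (hsub ht)).continuousWithinAt).mono hsub) (hd γ₂ h₂)
      (fun _ _ => trivial) le_rfl b (right_mem_Icc.2 hab)
    refine this.trans ?_
    gcongr
    linarith [ha.1, hb.2]
  · -- reverse time about `a`
    have hmaps : ∀ r ∈ Icc 0 (a - b), a - r ∈ Icc 0 T := fun r hr =>
      ⟨by linarith [hr.2, hb.1], by linarith [hr.1, ha.2]⟩
    have hd : ∀ γ : ℝ → F, (∀ t ∈ Icc 0 T, HasDerivWithinAt γ (W t (γ t)) (Icc 0 T) t) →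
        ∀ r ∈ Icc 0 (a - b), HasDerivWithinAt (fun r => γ (a - r)) (-W (a - r) (γ (a - r)))
          (Icc 0 (a - b)) r := by
      intro γ h r hr
      have := (h (a - r) (hmaps r hr)).scomp r
        ((hasDerivAt_id r).const_sub a).hasDerivWithinAt (fun r hr => hmaps r hr)
      simpa [Function.comp_def] using this
    have hd' : ∀ γ : ℝ → F, (∀ t ∈ Icc 0 T, HasDerivWithinAt γ (W t (γ t)) (Icc 0 T) t) →
        ∀ r ∈ Ico 0 (a - b), HasDerivWithinAt (fun r => γ (a - r)) (-W (a - r) (γ (a - r)))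
          (Ici r) r := by
      intro γ h r hr
      refine (hd γ h r (Ico_subset_Icc_self hr)).mono_of_mem_nhdsWithin ?_
      exact Filter.mem_of_superset (Icc_mem_nhdsGE hr.2) (Icc_subset_Icc hr.1 le_rfl)
    have := dist_le_of_trajectories_ODE_of_mem (v := fun r z => -W (a - r) z)
      (s := fun _ => univ) (K := L)
      (f := fun r => γ₁ (a - r)) (g := fun r => γ₂ (a - r)) (a := 0) (b := a - b)
      (δ := dist (γ₁ a) (γ₂ a))
      (fun r hr => (hW _ (hmaps r (Ico_subset_Icc_self hr))).neg.lipschitzOnWith)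
      (fun r hr => (hd γ₁ h₁ r hr).continuousWithinAt) (hd' γ₁ h₁)
      (fun _ _ => trivial)
      (fun r hr => (hd γ₂ h₂ r hr).continuousWithinAt) (hd' γ₂ h₂)
      (fun _ _ => trivial) (by simp) (a - b) (right_mem_Icc.2 (by linarith))
    simp only [sub_sub_cancel, sub_zero] at this
    refine this.trans ?_
    gcongr
    linarith [ha.2, hb.1]

/-! ### The phase space flow -/

/-- The vector field `(x, v) ↦ (v̂, E(s, x))` on phase space. -/
noncomputable def phaseField (E : ℝ → R3 → R3) (s : ℝ) (z : R3 × R3) : R3 × R3 :=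
  (hatv z.2, E s z.1)

/-- The characteristics as a two-parameter family of maps of phase space: `flow X V s t z` is the
position and velocity at time `s` of the particle that is at `z` at time `t`. -/
def flow (X V : ℝ → ℝ → R3 → R3 → R3) (s t : ℝ) (z : R3 × R3) : R3 × R3 :=
  (X s t z.1 z.2, V s t z.1 z.2)

lemma lipschitzWith_phaseField {E : ℝ → R3 → R3} {K : ℝ≥0} {s : ℝ}
    (hE : LipschitzWith K (E s)) : LipschitzWith (max 2 K) (phaseField E s) := by
  have h1 : LipschitzWith 2 (fun z : R3 × R3 => hatv z.2) := by
    simpa [Function.comp_def] using lipschitzWith_hatv.comp LipschitzWith.prod_snd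
  have h2 : LipschitzWith K (fun z : R3 × R3 => E s z.1) := by
    simpa [Function.comp_def] using hE.comp LipschitzWith.prod_fst
  exact h1.prodMk h2

section Flow

variable {T : ℝ} {E : ℝ → R3 → R3} {X V : ℝ → ℝ → R3 → R3 → R3}

lemma flow_self (h : IsCharacteristics T E X V) {t : ℝ} (ht : t ∈ Icc 0 T) (z : R3 × R3) :
    flow X V t t z = z := by
  simp [flow, h.init_X t ht, h.init_V t ht]

lemma hasDerivWithinAt_flow (h : IsCharacteristics T E X V) {s t : ℝ} (ht : t ∈ Icc 0 T)
    (hs : s ∈ Icc 0 T) (z : R3 × R3) :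
    HasDerivWithinAt (fun r => flow X V r t z) (phaseField E s (flow X V s t z)) (Icc 0 T) s :=
  (h.deriv_X t ht z.1 z.2 s hs).prodMk (h.deriv_V t ht z.1 z.2 s hs)

lemma dist_flow_le (h : IsCharacteristics T E X V) {K : ℝ≥0}
    (hK : ∀ t ∈ Icc 0 T, LipschitzWith K (E t)) {a b s t : ℝ} (ha : a ∈ Icc 0 T)
    (hb : b ∈ Icc 0 T) (hs : s ∈ Icc 0 T) (ht : t ∈ Icc 0 T) (z w : R3 × R3) :
    dist (flow X V b s z) (flow X V b t w)
      ≤ dist (flow X V a s z) (flow X V a t w) * Real.exp ((max 2 K : ℝ≥0) * T) :=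
  dist_le_exp_of_solutions (fun t ht => lipschitzWith_phaseField (hK t ht))
    (fun _ hr => hasDerivWithinAt_flow h hs hr z) (fun _ hr => hasDerivWithinAt_flow h ht hr w)
    ha hb

lemma flow_flow (h : IsCharacteristics T E X V) {K : ℝ≥0}
    (hK : ∀ t ∈ Icc 0 T, LipschitzWith K (E t)) {r s t : ℝ} (hr : r ∈ Icc 0 T)
    (hs : s ∈ Icc 0 T) (ht : t ∈ Icc 0 T) (z : R3 × R3) :
    flow X V r s (flow X V s t z) = flow X V r t z := by
  have := dist_flow_le h hK hs hr hs ht (flow X V s t z) z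
  rw [flow_self h hs, dist_self, zero_mul] at this
  exact dist_le_zero.1 this

lemma lipschitzWith_flow (h : IsCharacteristics T E X V) {K : ℝ≥0}
    (hK : ∀ t ∈ Icc 0 T, LipschitzWith K (E t)) {s t : ℝ} (hs : s ∈ Icc 0 T)
    (ht : t ∈ Icc 0 T) :
    LipschitzWith (Real.exp ((max 2 K : ℝ≥0) * T)).toNNReal (flow X V s t) := by
  refine LipschitzWith.of_dist_le_mul fun z w => ?_
  have := dist_flow_le h hK ht hs ht ht z w
  rwa [flow_self h ht, flow_self h ht, mul_comm, ← Real.coe_toNNReal _ (Real.exp_pos _).le] at this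

/-- Characteristics have speed at most `max 1 C`, for the sup norm on phase space. -/
lemma dist_flow_flow_le (h : IsCharacteristics T E X V) {C : ℝ}
    (hC : ∀ t ∈ Icc 0 T, ∀ x, ‖E t x‖ ≤ C) {r s t : ℝ} (hr : r ∈ Icc 0 T)
    (hs : s ∈ Icc 0 T) (ht : t ∈ Icc 0 T) (z : R3 × R3) :
    dist (flow X V r t z) (flow X V s t z) ≤ max 1 C * |r - s| := by
  rw [dist_eq_norm]
  refine (convex_Icc 0 T).norm_image_sub_le_of_norm_hasDerivWithin_le
    (f := fun r => flow X V r t z)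
    (fun x hx => hasDerivWithinAt_flow h ht hx z) (fun x hx => ?_) hs hr
  exact max_le_max (norm_hatv_le_one _) (hC x hx _)

end Flow

/-! ### Liouville's theorem -/

/-- Two measures finite on compact sets agree if they integrate compactly supported Lipschitz
functions in the same way. -/
lemma measure_eq_of_integral_lipschitz_eq {F : Type*} [NormedAddCommGroup F] [NormedSpace ℝ F]
    [FiniteDimensional ℝ F] [MeasurableSpace F] [BorelSpace F] {μ ν : Measure F}
    [IsFiniteMeasureOnCompacts μ] [IsFiniteMeasureOnCompacts ν] [Nontrivial F]
    (h : ∀ (g : F → ℝ) (K : ℝ≥0), LipschitzWith K g → HasCompactSupport g →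
      ∫ z, g z ∂μ = ∫ z, g z ∂ν) : μ = ν := by
  have : ProperSpace F := FiniteDimensional.proper_real F
  have key : ∀ U : Set F, IsOpen U → Bornology.IsBounded U → μ U = ν U := by
    intro U hU hb
    have hne : (Uᶜ).Nonempty := by
      by_contra hcon
      rw [not_nonempty_iff_eq_empty, compl_empty_iff] at hcon
      subst hcon
      exact NormedSpace.unbounded_univ ℝ F hb
    have hcomp : IsCompact (closure U) := hb.isCompact_closure
    -- Lipschitz functions increasing to the indicator of `U`
    let g : ℕ → F → ℝ := fun n z => min 1 (n * Metric.infDist z Uᶜ)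
    have hglip : ∀ n : ℕ, LipschitzWith n (g n) := fun n => by
      have h1 : LipschitzWith (n * 1) (fun z => (n : ℝ) * Metric.infDist z Uᶜ) := by
        refine LipschitzWith.of_dist_le_mul fun z w => ?_
        rw [Real.dist_eq, ← mul_sub, abs_mul, Nat.abs_cast, ← Real.dist_eq]
        push_cast
        rw [mul_one]
        gcongr
        simpa using (Metric.lipschitz_infDist_pt Uᶜ).dist_le_mul z w
      simpa using h1.const_min 1
    have hg0 : ∀ n z, z ∉ U → g n z = 0 := fun n z hz => by
      simp [g, Metric.infDist_zero_of_mem (mem_compl hz)]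
    have hgsupp : ∀ n, HasCompactSupport (g n) := fun n =>
      HasCompactSupport.intro hcomp fun z hz => hg0 n z fun hzU => hz (subset_closure hzU)
    have hgle : ∀ n z, ‖g n z‖ ≤ (closure U).indicator (fun _ => (1 : ℝ)) z := fun n z => by
      by_cases hz : z ∈ U
      · rw [indicator_of_mem (subset_closure hz), Real.norm_of_nonneg
          (le_min zero_le_one (mul_nonneg n.cast_nonneg Metric.infDist_nonneg))]
        exact min_le_left _ _
      · rw [hg0 n z hz, norm_zero]
        exact indicator_nonneg (fun _ _ => zero_le_one) _
    have hglim : ∀ z, Filter.Tendsto (fun n => g n z) Filter.atTop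
        (nhds (U.indicator (fun _ => (1 : ℝ)) z)) := fun z => by
      by_cases hz : z ∈ U
      · rw [indicator_of_mem hz]
        have hpos : 0 < Metric.infDist z Uᶜ :=
          (hU.isClosed_compl.notMem_iff_infDist_pos hne).1 (by simpa using hz)
        have : Filter.Tendsto (fun n : ℕ => (n : ℝ) * Metric.infDist z Uᶜ) Filter.atTop
            Filter.atTop := tendsto_natCast_atTop_atTop.atTop_mul_const hpos
        refine tendsto_const_nhds.congr' ?_
        filter_upwards [this.eventually_ge_atTop 1] with n hn
        exact (min_eq_left hn).symm
      · rw [indicator_of_notMem hz]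
        simp [hg0 _ z hz]
    have hlim : ∀ (ρ : Measure F) [IsFiniteMeasureOnCompacts ρ],
        Filter.Tendsto (fun n => ∫ z, g n z ∂ρ) Filter.atTop (nhds (ρ.real U)) := by
      intro ρ _
      rw [← integral_indicator_one hU.measurableSet]
      refine tendsto_integral_of_dominated_convergence _
        (fun n => (hglip n).continuous.aestronglyMeasurable)
        ((integrable_indicator_iff hcomp.isClosed.measurableSet).2
          (integrableOn_const hcomp.measure_lt_top.ne))
        (fun n => Filter.Eventually.of_forall (hgle n)) (Filter.Eventually.of_forall hglim)
    have hreal : μ.real U = ν.real U :=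
      tendsto_nhds_unique ((hlim μ).congr fun n => h _ _ (hglip n) (hgsupp n)) (hlim ν)
    exact (measureReal_eq_measureReal_iff hb.measure_lt_top.ne hb.measure_lt_top.ne).1 hreal
  refine Measure.ext_of_generateFrom_of_cover (S := {U | IsOpen U})
    (T := range fun n : ℕ => Metric.ball (0 : F) n) BorelSpace.measurable_eq
    (countable_range _) (fun U hU W hW _ => IsOpen.inter hU hW) ?_ ?_ ?_ ?_
  · rw [sUnion_range]
    exact Metric.iUnion_ball_nat 0
  · rintro _ ⟨n, rfl⟩
    exact Metric.isBounded_ball.measure_lt_top.ne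
  · rintro _ ⟨n, rfl⟩ U hU
    exact key _ (IsOpen.inter hU Metric.isOpen_ball)
      (Metric.isBounded_ball.subset inter_subset_right)
  · rintro _ ⟨n, rfl⟩
    exact key _ Metric.isOpen_ball Metric.isBounded_ball

/-- One step of the splitting scheme for the phase space flow: a drift `x ↦ x + h v̂` followed by
a kick `v ↦ v + h e(x)`. -/
noncomputable def splitStep (e : R3 → R3) (h : ℝ) (z : R3 × R3) : R3 × R3 :=
  (z.1 + h • hatv z.2, z.2 + h • e (z.1 + h • hatv z.2))

lemma measurePreserving_splitStep {e : R3 → R3} (he : Continuous e) (h : ℝ) :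
    MeasurePreserving (splitStep e h) := by
  have shear : ∀ c : R3 → R3, Continuous c →
      MeasurePreserving (fun z : R3 × R3 => (z.1, z.2 + c z.1)) := by
    intro c hc
    refine (MeasurePreserving.id (volume : Measure R3)).skew_product
      (g := fun x v => v + c x) (by fun_prop) ?_
    exact Filter.Eventually.of_forall fun x => (measurePreserving_add_right volume (c x)).map_eq
  have hkick := shear (fun x => h • e x) (by fun_prop)
  have hdrift := shear (fun v => h • hatv v) (by
    have := contDiff_hatv (n := 0).continuous
    fun_prop)
  have hswap : MeasurePreserving (Prod.swap : R3 × R3 → R3 × R3) :=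
    Measure.measurePreserving_swap
  exact hkick.comp (hswap.comp (hdrift.comp hswap))

section Flow

variable {T : ℝ} {E : ℝ → R3 → R3} {X V : ℝ → ℝ → R3 → R3 → R3}

/-- The splitting step approximates the flow to first order in the time step, uniformly on bounded
sets. -/
lemma exists_dist_flow_splitStep_le (h : IsCharacteristics T E X V)
    (hE : ContinuousOn (fun p : ℝ × R3 => E p.1 p.2) (Icc 0 T ×ˢ univ)) {C : ℝ}
    (hC : ∀ t ∈ Icc 0 T, ∀ x, ‖E t x‖ ≤ C) (R : ℝ) {ε : ℝ} (hε : 0 < ε) :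
    ∃ δ > 0, ∀ a ∈ Icc 0 T, ∀ b ∈ Icc 0 T, a ≤ b → b - a < δ → ∀ z : R3 × R3, ‖z‖ ≤ R →
      dist (flow X V b a z) (splitStep (E a) (b - a) z) ≤ ε * (b - a) := by
  set D : ℝ := max 1 C
  have hD : 1 ≤ D := le_max_left _ _
  set Q : Set (ℝ × R3) := Icc 0 T ×ˢ Metric.closedBall 0 (R + D * T + T)
  have hQ : IsCompact Q := isCompact_Icc.prod (isCompact_closedBall _ _)
  have hunif := hQ.uniformContinuousOn_of_continuous
    (hE.mono (prod_mono_right (subset_univ _)))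
  obtain ⟨δ₀, hδ₀, hδE⟩ := Metric.uniformContinuousOn_iff_le.1 hunif ε hε
  refine ⟨min (δ₀ / (1 + D)) (ε / (2 * D)), by positivity, fun a ha b hb hab hlt z hz => ?_⟩
  have hlt₁ : (b - a) * (1 + D) ≤ δ₀ := by
    rw [← le_div_iff₀ (by positivity)]
    exact (hlt.trans_le (min_le_left _ _)).le
  have hlt₂ : (b - a) * (2 * D) ≤ ε := by
    rw [← le_div_iff₀ (by positivity)]
    exact (hlt.trans_le (min_le_right _ _)).le
  have hba : 0 ≤ b - a := sub_nonneg.2 hab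
  have hbaT : b - a ≤ T := by linarith [ha.1, hb.2]
  have hT : 0 ≤ T := hba.trans hbaT
  have hsub : Icc a b ⊆ Icc 0 T := Icc_subset_Icc ha.1 hb.2
  have hmove : ∀ s ∈ Icc a b, dist (flow X V s a z) z ≤ D * (b - a) := fun s hs => by
    have := dist_flow_flow_le h hC (hsub hs) ha ha z
    rw [flow_self h ha, abs_of_nonneg (sub_nonneg.2 hs.1)] at this
    refine this.trans ?_
    gcongr
    exact hs.2
  have hx : ∀ s ∈ Icc a b, dist (X s a z.1 z.2) z.1 ≤ D * (b - a) := fun s hs =>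
    (le_max_left _ _).trans (hmove s hs)
  have hv : ∀ s ∈ Icc a b, dist (V s a z.1 z.2) z.2 ≤ D * (b - a) := fun s hs =>
    (le_max_right _ _).trans (hmove s hs)
  have hz1 : ‖z.1‖ ≤ R := (norm_fst_le z).trans hz
  set y : R3 := z.1 + (b - a) • hatv z.2 with hy
  have hyz : dist z.1 y ≤ b - a := by
    rw [hy, dist_self_add_right, norm_smul, Real.norm_of_nonneg hba]
    exact mul_le_of_le_one_right hba (norm_hatv_le_one _)
  refine max_le ?_ ?_
  · have := norm_image_sub_le_of_norm_deriv_le_segment'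
      (f := fun s => X s a z.1 z.2 - (s - a) • hatv z.2) (C := ε) (a := a) (b := b)
      (f' := fun s => hatv (V s a z.1 z.2) - (1 : ℝ) • hatv z.2)
      (fun s hs => ((h.deriv_X a ha z.1 z.2 s (hsub hs)).mono hsub).sub
        (((hasDerivAt_id s).sub_const a).smul_const _).hasDerivWithinAt)
      (fun s hs => ?_) b (right_mem_Icc.2 hab)
    · rw [dist_eq_norm]
      refine le_trans (le_of_eq ?_) this
      simp only [flow, splitStep, h.init_X a ha, sub_self, zero_smul, sub_zero]
      congr 1
      abel
    · rw [one_smul, ← dist_eq_norm]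
      have h1 := lipschitzWith_hatv.dist_le_mul (V s a z.1 z.2) z.2
      have h2 := hv s (Ico_subset_Icc_self hs)
      push_cast at h1
      nlinarith
  · have := norm_image_sub_le_of_norm_deriv_le_segment'
      (f := fun s => V s a z.1 z.2 - (s - a) • E a y) (C := ε) (a := a) (b := b)
      (f' := fun s => E s (X s a z.1 z.2) - (1 : ℝ) • E a y)
      (fun s hs => ((h.deriv_V a ha z.1 z.2 s (hsub hs)).mono hsub).sub
        (((hasDerivAt_id s).sub_const a).smul_const _).hasDerivWithinAt)
      (fun s hs => ?_) b (right_mem_Icc.2 hab)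
    · rw [dist_eq_norm]
      refine le_trans (le_of_eq ?_) this
      simp only [flow, splitStep, h.init_V a ha, sub_self, zero_smul, sub_zero]
      congr 1
      rw [← hy]
      abel
    · rw [one_smul, ← dist_eq_norm]
      have hxs := hx s (Ico_subset_Icc_self hs)
      have hDT : D * (b - a) ≤ D * T := by gcongr
      refine hδE (s, X s a z.1 z.2) ⟨hsub (Ico_subset_Icc_self hs), ?_⟩ (a, y) ⟨ha, ?_⟩ ?_
      · rw [mem_closedBall_zero_iff]
        have := norm_le_norm_add_norm_sub' (X s a z.1 z.2) z.1
        rw [← dist_eq_norm] at this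
        linarith
      · rw [mem_closedBall_zero_iff]
        have := norm_le_norm_add_norm_sub' y z.1
        rw [← dist_eq_norm, dist_comm] at this
        have : 0 ≤ D * T := by positivity
        linarith
      · refine max_le ?_ ?_
        · rw [Real.dist_eq, abs_of_nonneg (sub_nonneg.2 hs.1)]
          have : s - a ≤ b - a := by linarith [hs.2]
          have : 0 ≤ (b - a) * D := by positivity
          linarith
        · have := dist_triangle (X s a z.1 z.2) z.1 y
          simp only
          linarith

/-- The integral of a Lipschitz test function along the flow does not depend on the initial time:
on a time step `b - a` the flow differs by `o(b - a)` from a composition of two shears. -/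
lemma integral_comp_flow_eq (h : IsCharacteristics T E X V)
    (hE : ContinuousOn (fun p : ℝ × R3 => E p.1 p.2) (Icc 0 T ×ˢ univ)) {C : ℝ}
    (hC : ∀ t ∈ Icc 0 T, ∀ x, ‖E t x‖ ≤ C) {K : ℝ≥0}
    (hK : ∀ t ∈ Icc 0 T, LipschitzWith K (E t)) {τ : ℝ} (hτ : τ ∈ Icc 0 T)
    {g : R3 × R3 → ℝ} {M : ℝ≥0} (hg : LipschitzWith M g) (hgs : HasCompactSupport g) :
    ∫ z, g (flow X V τ 0 z) = ∫ z, g z := by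
  set D : ℝ := max 1 C
  have hD : 1 ≤ D := le_max_left _ _
  have hT : 0 ≤ T := hτ.1.trans hτ.2
  have hsub : Icc 0 τ ⊆ Icc 0 T := Icc_subset_Icc le_rfl hτ.2
  obtain ⟨R₀, hR₀⟩ := hgs.isCompact.isBounded.subset_closedBall 0
  have hg0 : ∀ z, R₀ < ‖z‖ → g z = 0 := fun z hz => by
    by_contra hne
    have := hR₀ (subset_tsupport g hne)
    rw [mem_closedBall_zero_iff] at this
    linarith
  set R : ℝ := R₀ + D * T + D * T
  have hDT : 0 ≤ D * T := by positivity
  set Λ : ℝ≥0 := M * (Real.exp ((max 2 K : ℝ≥0) * T)).toNNReal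
  set Ω : Set (R3 × R3) := Metric.closedBall 0 R
  have hlip : ∀ s ∈ Icc 0 τ, LipschitzWith Λ fun z => g (flow X V τ s z) := fun s hs =>
    hg.comp (lipschitzWith_flow h hK hτ (hsub hs))
  have hvan : ∀ s ∈ Icc 0 τ, ∀ z, R₀ + D * T < ‖z‖ → g (flow X V τ s z) = 0 := by
    intro s hs z hz
    apply hg0
    have h1 := dist_flow_flow_le h hC hτ (hsub hs) (hsub hs) z
    rw [flow_self h (hsub hs), abs_of_nonneg (sub_nonneg.2 hs.2)] at h1
    have h2 : D * (τ - s) ≤ D * T := by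
      gcongr
      linarith [hs.1, hτ.2]
    have h3 := norm_le_norm_add_norm_sub (flow X V τ s z) z
    rw [← dist_eq_norm] at h3
    linarith
  have hint : ∀ s ∈ Icc 0 τ, Integrable fun z => g (flow X V τ s z) := fun s hs =>
    (hlip s hs).continuous.integrable_of_hasCompactSupport
      (HasCompactSupport.intro (isCompact_closedBall (0 : R3 × R3) (R₀ + D * T)) fun z hz =>
        hvan s hs z (by simpa [mem_closedBall_zero_iff] using hz))
  set n : ℝ → ℝ := fun s => ∫ z, g (flow X V τ s z)
  have step : ∀ ε > 0, ∃ δ > 0, ∀ a ∈ Icc 0 τ, ∀ b ∈ Icc 0 τ, a ≤ b → b - a < δ →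
      ‖n b - n a‖ ≤ ε * (b - a) := by
    intro ε hε
    set B : ℝ := Λ * volume.real Ω + 1
    have hB : 0 < B := by positivity
    obtain ⟨δ, hδ, hstep⟩ := exists_dist_flow_splitStep_le h hE hC R (div_pos hε hB)
    refine ⟨δ, hδ, fun a ha b hb hab hlt => ?_⟩
    set A := splitStep (E a) (b - a)
    have hA : MeasurePreserving A :=
      measurePreserving_splitStep (hK a (hsub ha)).continuous _
    have hAint : Integrable fun z => g (flow X V τ b (A z)) :=
      hA.integrable_comp_of_integrable (hint b hb)
    have hba : 0 ≤ b - a := sub_nonneg.2 hab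
    have hnb : n b = ∫ z, g (flow X V τ b (A z)) := by
      have := integral_map (μ := volume) hA.measurable.aemeasurable
        (f := fun z => g (flow X V τ b z)) (hlip b hb).continuous.aestronglyMeasurable
      rw [hA.map_eq] at this
      exact this
    have hna : n a = ∫ z, g (flow X V τ b (flow X V b a z)) := by
      simp only [n, flow_flow h hK hτ (hsub hb) (hsub ha)]
    have hbaT : b - a ≤ T := by linarith [ha.1, hb.2, hτ.2]
    have hpt : ∀ z, ‖g (flow X V τ b (A z)) - g (flow X V τ b (flow X V b a z))‖
        ≤ Ω.indicator (fun _ => Λ * (ε / B * (b - a))) z := by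
      intro z
      by_cases hz : z ∈ Ω
      · rw [indicator_of_mem hz, ← dist_eq_norm, dist_comm]
        refine ((hlip b hb).dist_le_mul _ _).trans ?_
        gcongr
        exact hstep a (hsub ha) b (hsub hb) hab hlt z (by simpa [Ω] using hz)
      · rw [indicator_of_notMem hz]
        have hz' : R < ‖z‖ := by simpa [Ω] using hz
        rw [flow_flow h hK hτ (hsub hb) (hsub ha), hvan a ha z (by linarith),
          sub_zero, norm_le_zero_iff]
        -- away from the ball only positions and velocities of size at least `R₀ + D * T` occur
        apply hvan b hb
        have h1 : dist z (A z) ≤ D * T := by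
          refine max_le ?_ ?_
          · simp only [A, splitStep, dist_self_add_right, norm_smul, Real.norm_of_nonneg hba]
            calc (b - a) * ‖hatv z.2‖ ≤ T * 1 := by
                  gcongr
                  exact norm_hatv_le_one _
              _ ≤ D * T := by nlinarith
          · simp only [A, splitStep, dist_self_add_right, norm_smul, Real.norm_of_nonneg hba]
            calc (b - a) * ‖E a (z.1 + (b - a) • hatv z.2)‖ ≤ T * D := by
                  gcongr
                  exact (hC a (hsub ha) _).trans (le_max_right _ _)
              _ = D * T := mul_comm _ _
        have h2 := norm_le_norm_add_norm_sub' z (A z)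
        rw [← dist_eq_norm] at h2
        linarith
    rw [hnb, hna, ← integral_sub hAint (by
      simpa only [flow_flow h hK hτ (hsub hb) (hsub ha)] using hint a ha)]
    have hΩ : MeasurableSet Ω := Metric.isClosed_closedBall.measurableSet
    refine (norm_integral_le_of_norm_le ((integrable_indicator_iff hΩ).2
      (integrableOn_const (isCompact_closedBall _ _).measure_lt_top.ne))
      (Filter.Eventually.of_forall hpt)).trans ?_
    rw [integral_indicator hΩ, setIntegral_const, smul_eq_mul]
    calc volume.real Ω * (Λ * (ε / B * (b - a))) = (Λ * volume.real Ω) * (ε / B * (b - a)) := by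
          ring
      _ ≤ B * (ε / B * (b - a)) := by
          gcongr
          simp [B]
      _ = ε * (b - a) := by field_simp
  have hder : ∀ x ∈ Ico 0 τ, HasDerivWithinAt n 0 (Ici x) x := by
    intro x hx
    rw [hasDerivWithinAt_iff_isLittleO, Asymptotics.isLittleO_iff]
    intro ε hε
    obtain ⟨δ, hδ, hstep⟩ := step ε hε
    filter_upwards [Ico_mem_nhdsGE (lt_min (lt_add_of_pos_right x hδ) hx.2)] with b hb
    have hb1 : b < x + δ := hb.2.trans_le (min_le_left _ _)
    have hb2 : b < τ := hb.2.trans_le (min_le_right _ _)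
    rw [smul_zero, sub_zero, Real.norm_of_nonneg (sub_nonneg.2 hb.1)]
    exact hstep x ⟨hx.1, hx.2.le⟩ b ⟨hx.1.trans hb.1, hb2.le⟩ hb.1 (by linarith)
  have hcont : ContinuousOn n (Icc 0 τ) := by
    obtain ⟨δ, hδ, hstep⟩ := step 1 one_pos
    refine Metric.continuousOn_iff.2 fun x hx ε hε => ⟨min δ ε, lt_min hδ hε, fun b hb hbx => ?_⟩
    have h1 := hbx.trans_le (min_le_left _ _)
    have h2 := hbx.trans_le (min_le_right _ _)
    rw [Real.dist_eq, abs_lt] at h1 h2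
    rcases le_total x b with hxb | hxb
    · have := hstep x hx b hb hxb (by linarith)
      rw [dist_eq_norm]
      linarith
    · have := hstep b hb x hx hxb (by linarith)
      rw [dist_comm, dist_eq_norm]
      linarith
  have := constant_of_has_deriv_right_zero hcont hder τ (right_mem_Icc.2 hτ.1)
  simp only [n, flow_self h hτ] at this
  exact this.symm

/-- **Liouville's theorem**. The field is merely Lipschitz, so the flow need not be differentiable
and there is no Jacobian determinant to compute. -/
lemma measurePreserving_flow_zero (h : IsCharacteristics T E X V)
    (hE : ContinuousOn (fun p : ℝ × R3 => E p.1 p.2) (Icc 0 T ×ˢ univ)) {C : ℝ}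
    (hC : ∀ t ∈ Icc 0 T, ∀ x, ‖E t x‖ ≤ C) {K : ℝ≥0}
    (hK : ∀ t ∈ Icc 0 T, LipschitzWith K (E t)) {τ : ℝ} (hτ : τ ∈ Icc 0 T) :
    MeasurePreserving (flow X V τ 0) := by
  have h0 : (0 : ℝ) ∈ Icc 0 T := ⟨le_rfl, hτ.1.trans hτ.2⟩
  have hcont : Continuous (flow X V τ 0) := (lipschitzWith_flow h hK hτ h0).continuous
  have hinv : Continuous (flow X V 0 τ) := (lipschitzWith_flow h hK h0 hτ).continuous
  have : IsFiniteMeasureOnCompacts (Measure.map (flow X V τ 0) volume) := by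
    refine ⟨fun Q hQ => ?_⟩
    rw [Measure.map_apply hcont.measurable hQ.measurableSet]
    refine (measure_mono fun z hz => ?_).trans_lt (hQ.image hinv).measure_lt_top
    exact ⟨_, hz, by rw [flow_flow h hK h0 hτ h0, flow_self h h0]⟩
  refine ⟨hcont.measurable, measure_eq_of_integral_lipschitz_eq fun g M hg hgs => ?_⟩
  rw [integral_map hcont.measurable.aemeasurable hg.continuous.aestronglyMeasurable]
  exact integral_comp_flow_eq h hE hC hK hτ hg hgs

end Flow

/-- The flow between the initial time and the time `τ`, seen as an invertible, volume preserving
family of maps of phase space, continuous in `(τ, z)` for all real `τ`; off the time interval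
`[0, T]` the time is frozen at the nearest end point. `fwd τ` moves points from time `0` to
time `τ`, `bwd τ` back from time `τ` to time `0`, and `e` is the field. -/
structure PhaseFlow (T : ℝ) (e : ℝ → R3 → R3) (fwd bwd : ℝ → R3 × R3 → R3 × R3) : Prop where
  continuous_field : Continuous fun p : ℝ × R3 => e p.1 p.2
  continuous_fwd : Continuous fun p : ℝ × (R3 × R3) => fwd p.1 p.2
  continuous_bwd : Continuous fun p : ℝ × (R3 × R3) => bwd p.1 p.2
  bwd_fwd : ∀ τ z, bwd τ (fwd τ z) = z
  fwd_bwd : ∀ τ z, fwd τ (bwd τ z) = z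
  fwd_zero : ∀ z, fwd 0 z = z
  measurePreserving_fwd : ∀ τ, MeasurePreserving (fwd τ)
  hasDerivAt_fst : ∀ z, ∀ τ ∈ Ioo 0 T, HasDerivAt (fun s => (fwd s z).1) (hatv (fwd τ z).2) τ
  hasDerivAt_snd : ∀ z, ∀ τ ∈ Ioo 0 T,
    HasDerivAt (fun s => (fwd s z).2) (e τ (fwd τ z).1) τ
  exists_norm_field_le : ∃ C, ∀ τ x, ‖e τ x‖ ≤ C
  exists_norm_le_add : ∃ C, ∀ τ z, ‖z.2‖ ≤ ‖(bwd τ z).2‖ + C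

lemma IsCharacteristics.phaseFlow {T : ℝ} {E : ℝ → R3 → R3} {X V : ℝ → ℝ → R3 → R3 → R3}
    (h : IsCharacteristics T E X V)
    (hE : ContinuousOn (fun p : ℝ × R3 => E p.1 p.2) (Icc 0 T ×ˢ univ)) {C : ℝ}
    (hC : ∀ t ∈ Icc 0 T, ∀ x, ‖E t x‖ ≤ C) {K : ℝ≥0}
    (hK : ∀ t ∈ Icc 0 T, LipschitzWith K (E t)) (hT : 0 ≤ T) :
    PhaseFlow T (fun τ => E (projIcc 0 T hT τ)) (fun τ => flow X V (projIcc 0 T hT τ) 0)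
      (fun τ => flow X V 0 (projIcc 0 T hT τ)) := by
  have h0 : (0 : ℝ) ∈ Icc 0 T := ⟨le_rfl, hT⟩
  have hp : ∀ τ, (projIcc 0 T hT τ : ℝ) ∈ Icc 0 T := fun τ => (projIcc 0 T hT τ).2
  have hpc : Continuous fun τ => (projIcc 0 T hT τ : ℝ) :=
    continuous_subtype_val.comp continuous_projIcc
  have hpI : ∀ τ ∈ Icc 0 T, (projIcc 0 T hT τ : ℝ) = τ := fun τ hτ => by
    rw [projIcc_of_mem hT hτ]
  have hpe : ∀ τ ∈ Ioo 0 T, ∀ᶠ s in nhds τ, (projIcc 0 T hT s : ℝ) = s := fun τ hτ => by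
    filter_upwards [Icc_mem_nhds hτ.1 hτ.2] with s hs using hpI s hs
  set Λ : ℝ := Real.exp ((max 2 K : ℝ≥0) * T)
  have hlip : ∀ s ∈ Icc 0 T, ∀ t ∈ Icc 0 T, ∀ z w,
      dist (flow X V s t z) (flow X V s t w) ≤ Λ * dist z w := fun s hs t ht z w => by
    have := (lipschitzWith_flow h hK hs ht).dist_le_mul z w
    rwa [Real.coe_toNNReal _ (Real.exp_pos _).le] at this
  refine
    { continuous_field := ?_
      continuous_fwd := ?_
      continuous_bwd := ?_
      bwd_fwd := fun τ z => by rw [flow_flow h hK h0 (hp τ) h0, flow_self h h0]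
      fwd_bwd := fun τ z => by rw [flow_flow h hK (hp τ) h0 (hp τ), flow_self h (hp τ)]
      fwd_zero := fun z => by rw [hpI 0 h0, flow_self h h0]
      measurePreserving_fwd := fun τ => measurePreserving_flow_zero h hE hC hK (hp τ)
      hasDerivAt_fst := fun z τ hτ => ?_
      hasDerivAt_snd := fun z τ hτ => ?_
      exists_norm_field_le := ⟨C, fun τ x => hC _ (hp τ) x⟩
      exists_norm_le_add := ⟨max 1 C * T, fun τ z => ?_⟩ }
  · exact hE.comp_continuous (f := fun p : ℝ × R3 => ((projIcc 0 T hT p.1 : ℝ), p.2))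
      (by fun_prop) fun p => ⟨hp _, mem_univ _⟩
  · refine continuous_iff_continuousAt.2 fun p => ?_
    refine tendsto_iff_dist_tendsto_zero.2 (squeeze_zero (fun _ => dist_nonneg)
      (g := fun q => Λ * dist q.2 p.2
        + max 1 C * |(projIcc 0 T hT q.1 : ℝ) - projIcc 0 T hT p.1|) (fun q => ?_) ?_)
    · exact (dist_triangle _ (flow X V (projIcc 0 T hT q.1) 0 p.2) _).trans
        (add_le_add (hlip _ (hp _) _ h0 _ _) (dist_flow_flow_le h hC (hp _) (hp _) h0 _))
    · have : Continuous fun q : ℝ × (R3 × R3) => Λ * dist q.2 p.2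
        + max 1 C * |(projIcc 0 T hT q.1 : ℝ) - projIcc 0 T hT p.1| := by fun_prop
      simpa using this.tendsto p
  · refine continuous_iff_continuousAt.2 fun p => ?_
    refine tendsto_iff_dist_tendsto_zero.2 (squeeze_zero (fun _ => dist_nonneg)
      (g := fun q => Λ * dist q.2 p.2
        + Λ * (max 1 C * |(projIcc 0 T hT q.1 : ℝ) - projIcc 0 T hT p.1|)) (fun q => ?_) ?_)
    · refine (dist_triangle _ (flow X V 0 (projIcc 0 T hT q.1) p.2) _).trans
        (add_le_add (hlip _ h0 _ (hp _) _ _) ?_)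
      -- flow from time `p.1` to time `q.1` first, then back to time `0`
      change dist _ (flow X V 0 (projIcc 0 T hT p.1 : ℝ) p.2) ≤ _
      rw [← flow_flow h hK h0 (hp q.1) (hp p.1) p.2, dist_comm]
      refine (hlip _ h0 _ (hp _) _ _).trans ?_
      have := dist_flow_flow_le h hC (hp q.1) (hp p.1) (hp p.1) p.2
      rw [flow_self h (hp p.1)] at this
      gcongr
    · have : Continuous fun q : ℝ × (R3 × R3) => Λ * dist q.2 p.2
        + Λ * (max 1 C * |(projIcc 0 T hT q.1 : ℝ) - projIcc 0 T hT p.1|) := by fun_prop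
      simpa using this.tendsto p
  · have hτ' := Ioo_subset_Icc_self hτ
    have := (h.deriv_X 0 h0 z.1 z.2 τ hτ').hasDerivAt (Icc_mem_nhds hτ.1 hτ.2)
    rw [hpI τ hτ']
    exact this.congr_of_eventuallyEq ((hpe τ hτ).mono fun s hs => by simp only [hs, flow])
  · have hτ' := Ioo_subset_Icc_self hτ
    have := (h.deriv_V 0 h0 z.1 z.2 τ hτ').hasDerivAt (Icc_mem_nhds hτ.1 hτ.2)
    rw [hpI τ hτ']
    exact this.congr_of_eventuallyEq ((hpe τ hτ).mono fun s hs => by simp only [hs, flow])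
  · have h1 := dist_flow_flow_le h hC (hp τ) h0 (hp τ) z
    rw [flow_self h (hp τ), sub_zero, abs_of_nonneg (hp τ).1] at h1
    have h2 : dist z.2 (flow X V 0 (projIcc 0 T hT τ) z).2 ≤ max 1 C * T :=
      (le_max_right _ _).trans (h1.trans (by gcongr; exact (hp τ).2))
    have h3 := norm_le_norm_add_norm_sub' z.2 (flow X V 0 (projIcc 0 T hT τ) z).2
    rw [← dist_eq_norm] at h3
    linarith

/-! ### Square integrable functions and their Fourier transforms -/

lemma toL2_eq_toLp {h : R3 → ℂ} (hh : MemLp h 2 volume) : toL2 h = hh.toLp h := by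
  simp [toL2, hh]

lemma coeFn_toL2 {h : R3 → ℂ} (hh : MemLp h 2 volume) : toL2 h =ᵐ[volume] h := by
  rw [toL2_eq_toLp hh]
  exact hh.coeFn_toLp

lemma toL2_congr {h h' : R3 → ℂ} (hh : h =ᵐ[volume] h') : toL2 h = toL2 h' := by
  by_cases hm : MemLp h 2 volume
  · rw [toL2_eq_toLp hm, toL2_eq_toLp (hm.ae_eq hh)]
    exact (MemLp.toLp_eq_toLp_iff _ _).2 hh
  · have hm' : ¬ MemLp h' 2 volume := fun h1 => hm (h1.ae_eq hh.symm)
    simp [toL2, hm, hm']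

@[simp] lemma toL2_zero : toL2 (fun _ => 0) = 0 := by
  rw [toL2_eq_toLp (MemLp.zero' (p := 2))]
  exact MemLp.toLp_zero _

lemma norm_sq_eq_integral (u : L2x) : ‖u‖ ^ 2 = ∫ x, ‖u x‖ ^ 2 := by
  have h1 := inner_self_eq_norm_sq_to_K (𝕜 := ℂ) u
  rw [L2.inner_def] at h1
  have h2 : ∫ x, ((‖u x‖ ^ 2 : ℝ) : ℂ) = ((∫ x, ‖u x‖ ^ 2 : ℝ) : ℂ) := integral_ofReal
  have h3 : ((‖u‖ ^ 2 : ℝ) : ℂ) = ((∫ x, ‖u x‖ ^ 2 : ℝ) : ℂ) := by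
    rw [← h2]
    push_cast
    refine h1.symm.trans (integral_congr_ae (Filter.Eventually.of_forall fun x => ?_))
    simp only [inner_self_eq_norm_sq_to_K]
    rfl
  exact_mod_cast h3

lemma norm_toL2_sq {h : R3 → ℂ} (hh : MemLp h 2 volume) : ‖toL2 h‖ ^ 2 = ∫ x, ‖h x‖ ^ 2 := by
  rw [norm_sq_eq_integral]
  exact integral_congr_ae ((coeFn_toL2 hh).mono fun x hx => by simp only [hx])

lemma norm_fourierInv_L2 (u : L2x) : ‖(𝓕⁻ u : L2x)‖ = ‖u‖ :=
  (Lp.fourierTransformₗᵢ R3 ℂ).symm.norm_map u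

lemma continuous_neg_innerₗ : Continuous fun p : R3 × R3 => (-innerₗ R3) p.1 p.2 := by
  simp only [LinearMap.neg_apply, innerₗ_apply_apply]
  fun_prop

/-- For an integrable and square integrable function, the inverse Fourier transform in `L²` is
given by the Fourier integral. -/
lemma fourierInv_toL2 {η : R3 → ℂ} (h1 : Integrable η) (h2 : MemLp η 2 volume) :
    (𝓕⁻ (toL2 η) : L2x) =ᵐ[volume] 𝓕⁻ η := by
  have hcont : Continuous (𝓕⁻ η) :=
    VectorFourier.fourierIntegral_continuous Real.continuous_fourierChar
      continuous_neg_innerₗ h1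
  refine ae_eq_of_integral_contDiff_smul_eq
    ((Lp.memLp _).locallyIntegrable (by norm_num)) hcont.locallyIntegrable fun g hg hgs => ?_
  have hgc : ContDiff ℝ ∞ fun x => (g x : ℂ) := Complex.ofRealCLM.contDiff.comp hg
  have hgcs : HasCompactSupport fun x => (g x : ℂ) := hgs.comp_left Complex.ofReal_zero
  let G : SchwartzMap R3 ℂ := hgcs.toSchwartzMap hgc
  have hG : ∀ x, G x = (g x : ℂ) := fun x => rfl
  have e1 : ∫ x, g x • (𝓕⁻ (toL2 η) : L2x) x = ∫ x, (𝓕⁻ G) x • η x := by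
    have := congrArg (fun S => S G) (Lp.fourierInv_toTemperedDistribution_eq (toL2 η))
    simp only [TemperedDistribution.fourierInv_apply, Lp.toTemperedDistribution_apply] at this
    simp only [hG, Complex.coe_smul] at this
    rw [← this]
    exact integral_congr_ae ((coeFn_toL2 h2).mono fun x hx => by simp only [hx])
  have e2 : ∫ x, (𝓕⁻ G) x • η x = ∫ x, G x • (𝓕⁻ η) x := by
    have := VectorFourier.integral_fourierIntegral_smul_eq_flip (L := -innerₗ R3)
      (μ := volume) (ν := volume) Real.continuous_fourierChar
      continuous_neg_innerₗ (G.integrable (μ := volume)) h1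
    have hflip : (-innerₗ R3).flip = -innerₗ R3 := by
      ext x y
      simp [real_inner_comm]
    rw [hflip] at this
    rw [SchwartzMap.fourierInv_coe]
    exact this
  rw [e1, e2]
  simp only [hG, Complex.coe_smul]

lemma fourier_eq_conj_fourierInv (η : R3 → ℂ) (x : R3) :
    𝓕 η x = starRingEnd ℂ (𝓕⁻ (fun ξ => starRingEnd ℂ (η ξ)) x) := by
  rw [Real.fourier_eq', Real.fourierInv_eq', ← integral_conj]
  refine integral_congr_ae (Filter.Eventually.of_forall fun ξ => ?_)
  simp [← Complex.exp_conj, Complex.conj_ofNat]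

lemma memLp_conj {η : R3 → ℂ} (h2 : MemLp η 2 volume) :
    MemLp (fun ξ => starRingEnd ℂ (η ξ)) 2 volume :=
  h2.of_le (Complex.continuous_conj.comp_aestronglyMeasurable h2.1)
    (Filter.Eventually.of_forall fun x => by simp)

lemma integrable_conj {η : R3 → ℂ} (h1 : Integrable η) :
    Integrable (fun ξ => starRingEnd ℂ (η ξ)) :=
  h1.mono (Complex.continuous_conj.comp_aestronglyMeasurable h1.1)
    (Filter.Eventually.of_forall fun x => by simp)

/-- **Plancherel's theorem** for Fourier integrals. -/
lemma memLp_fourier {η : R3 → ℂ} (h1 : Integrable η) (h2 : MemLp η 2 volume) :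
    MemLp (𝓕 η) 2 volume := by
  have h := (Lp.memLp (𝓕⁻ (toL2 fun ξ => starRingEnd ℂ (η ξ)) : L2x)).ae_eq
    (fourierInv_toL2 (integrable_conj h1) (memLp_conj h2))
  have := memLp_conj h
  exact this.ae_eq (Filter.Eventually.of_forall fun x => (fourier_eq_conj_fourierInv η x).symm)

lemma integral_norm_fourier_sq {η : R3 → ℂ} (h1 : Integrable η) (h2 : MemLp η 2 volume) :
    ∫ x, ‖𝓕 η x‖ ^ 2 = ∫ ξ, ‖η ξ‖ ^ 2 := by
  have h := norm_fourierInv_L2 (toL2 fun ξ => starRingEnd ℂ (η ξ))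
  have h' := norm_toL2_sq (memLp_conj h2)
  rw [← h, norm_sq_eq_integral] at h'
  simp only [RCLike.norm_conj] at h'
  rw [← h']
  refine integral_congr_ae ((fourierInv_toL2 (integrable_conj h1) (memLp_conj h2)).mono
    fun x hx => ?_)
  simp only [hx, fourier_eq_conj_fourierInv η x, RCLike.norm_conj]

/-- The functional `u ↦ ∫ η(ξ) û(ξ) dξ` on `L²`, for square integrable `η`; for all other `η` it
is zero. -/
noncomputable def fourierPairing (η : R3 → ℂ) : L2x →L[ℂ] ℂ :=
  (innerSL ℂ (toL2 fun ξ => starRingEnd ℂ (η ξ))).comp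
    (Lp.fourierTransformₗᵢ R3 ℂ).toContinuousLinearEquiv.toContinuousLinearMap

lemma fourierPairing_eq_inner (η : R3 → ℂ) (u : L2x) :
    fourierPairing η u = inner ℂ (toL2 fun ξ => starRingEnd ℂ (η ξ)) (𝓕 u : L2x) := rfl

lemma fourierPairing_apply {η : R3 → ℂ} (h2 : MemLp η 2 volume) (u : L2x) :
    fourierPairing η u = ∫ ξ, η ξ * (𝓕 u : L2x) ξ := by
  rw [fourierPairing_eq_inner, L2.inner_def]
  refine integral_congr_ae ((coeFn_toL2 (memLp_conj h2)).mono fun x hx => ?_)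
  simp only [hx, RCLike.inner_apply, RingHomCompTriple.comp_apply, RingHom.id_apply, mul_comm]

/-- The Fourier transform is symmetric for the bilinear pairing of `L²`. -/
lemma fourierPairing_eq_integral_fourier {η : R3 → ℂ} (h1 : Integrable η)
    (h2 : MemLp η 2 volume) (u : L2x) : fourierPairing η u = ∫ x, 𝓕 η x * u x := by
  have h : (toL2 fun ξ => starRingEnd ℂ (η ξ))
      = (𝓕 (𝓕⁻ (toL2 fun ξ => starRingEnd ℂ (η ξ)) : L2x) : L2x) :=
    (FourierTransform.fourier_fourierInv_eq _).symm
  rw [fourierPairing_eq_inner, h, Lp.inner_fourier_eq, L2.inner_def]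
  refine integral_congr_ae ((fourierInv_toL2 (integrable_conj h1) (memLp_conj h2)).mono
    fun x hx => ?_)
  simp only [hx, RCLike.inner_apply, fourier_eq_conj_fourierInv η x, mul_comm]

/-- Frequency cut-offs separate the points of `L²`. -/
lemma eq_of_fourierPairing_eq {u w : L2x}
    (h : ∀ χ : R3 → ℂ, Continuous χ → HasCompactSupport χ →
      fourierPairing χ u = fourierPairing χ w) : u = w := by
  have hF : (𝓕 u : L2x) = 𝓕 w := by
    refine Lp.ext (ae_eq_of_integral_contDiff_smul_eq
      ((Lp.memLp _).locallyIntegrable (by norm_num))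
      ((Lp.memLp _).locallyIntegrable (by norm_num)) fun g hg hgs => ?_)
    have hgc : Continuous fun x => (g x : ℂ) := Complex.continuous_ofReal.comp hg.continuous
    have hgcs : HasCompactSupport fun x => (g x : ℂ) := hgs.comp_left Complex.ofReal_zero
    have := h _ hgc hgcs
    rw [fourierPairing_apply (hgc.memLp_of_hasCompactSupport hgcs),
      fourierPairing_apply (hgc.memLp_of_hasCompactSupport hgcs)] at this
    simpa only [Complex.real_smul] using this
  exact (Lp.fourierTransformₗᵢ R3 ℂ).injective hF

/-! ### Fourier multipliers -/

section Multiplier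

variable {m : R3 → ℂ}

lemma memLp_symbol_mul (hm : Continuous m) {B : ℝ} (hB : ∀ k, ‖m k‖ ≤ B) {h : R3 → ℂ}
    (hh : MemLp h 2 volume) : MemLp (fun ξ => m ((2 * Real.pi) • ξ) * h ξ) 2 volume := by
  refine hh.of_le_mul (c := B) ((by fun_prop : Continuous fun ξ : R3 =>
    m ((2 * Real.pi) • ξ)).aestronglyMeasurable.mul hh.1)
    (Filter.Eventually.of_forall fun ξ => ?_)
  rw [norm_mul]
  gcongr
  exact hB _

lemma fourier_kerConv (m : R3 → ℂ) (u : L2x) :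
    (𝓕 (kerConv m u) : L2x) = toL2 fun ξ => m ((2 * Real.pi) • ξ) * (𝓕 u : L2x) ξ :=
  FourierTransform.fourier_fourierInv_eq _

lemma norm_kerConv_le (hm : Continuous m) {B : ℝ} (hB : ∀ k, ‖m k‖ ≤ B) (u : L2x) :
    ‖kerConv m u‖ ≤ B * ‖u‖ := by
  rw [kerConv, norm_fourierInv_L2, toL2_eq_toLp (memLp_symbol_mul hm hB (Lp.memLp _)),
    ← Lp.norm_fourier_eq u]
  refine Lp.norm_le_mul_norm_of_ae_le_mul ?_
  filter_upwards [(memLp_symbol_mul hm hB (Lp.memLp (𝓕 u : L2x))).coeFn_toLp] with ξ hξ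
  rw [hξ, norm_mul]
  gcongr
  exact hB _

lemma kerConv_sub (hm : Continuous m) {B : ℝ} (hB : ∀ k, ‖m k‖ ≤ B) (u w : L2x) :
    kerConv m (u - w) = kerConv m u - kerConv m w := by
  apply (Lp.fourierTransformₗᵢ R3 ℂ).injective
  rw [map_sub]
  change (𝓕 (kerConv m (u - w)) : L2x) = (𝓕 (kerConv m u) : L2x) - (𝓕 (kerConv m w) : L2x)
  have hsub : (𝓕 (u - w) : L2x) = 𝓕 u - 𝓕 w := map_sub (Lp.fourierTransformₗᵢ R3 ℂ) u w
  rw [fourier_kerConv, fourier_kerConv, fourier_kerConv, hsub,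
    toL2_eq_toLp (memLp_symbol_mul hm hB (Lp.memLp (𝓕 u : L2x))),
    toL2_eq_toLp (memLp_symbol_mul hm hB (Lp.memLp (𝓕 w : L2x))), ← MemLp.toLp_sub,
    ← toL2_eq_toLp]
  refine toL2_congr ((Lp.coeFn_sub (𝓕 u : L2x) (𝓕 w : L2x)).mono fun ξ hξ => ?_)
  simp only [hξ, Pi.sub_apply, mul_sub]

lemma kerConv_zero : kerConv m 0 = 0 := by
  have h : (𝓕 (0 : L2x) : L2x) = 0 := map_zero (Lp.fourierTransformₗᵢ R3 ℂ)
  have h' : (𝓕⁻ (0 : L2x) : L2x) = 0 := map_zero (Lp.fourierTransformₗᵢ R3 ℂ).symm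
  have h0 : (toL2 fun ξ => m ((2 * Real.pi) • ξ) * (0 : L2x) ξ) = 0 := by
    refine Eq.trans (toL2_congr ?_) toL2_zero
    filter_upwards [Lp.coeFn_zero ℂ 2 (volume : Measure R3)] with ξ hξ
    rw [hξ, Pi.zero_apply, mul_zero]
  rw [kerConv, h, h0, h']

lemma kerConv_add (hm : Continuous m) {B : ℝ} (hB : ∀ k, ‖m k‖ ≤ B) (u w : L2x) :
    kerConv m (u + w) = kerConv m u + kerConv m w := by
  have h1 := kerConv_sub hm hB (u + w) w
  rw [add_sub_cancel_right] at h1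
  rw [h1, sub_add_cancel]

lemma kerConv_sum {ι : Type*} (s : Finset ι) (hm : Continuous m) {B : ℝ}
    (hB : ∀ k, ‖m k‖ ≤ B) (u : ι → L2x) :
    kerConv m (∑ i ∈ s, u i) = ∑ i ∈ s, kerConv m (u i) := by
  classical
  induction s using Finset.induction_on with
  | empty => simp [kerConv_zero]
  | insert i s hi ih => rw [Finset.sum_insert hi, Finset.sum_insert hi, kerConv_add hm hB, ih]

lemma fourierPairing_kerConv (hm : Continuous m) {B : ℝ} (hB : ∀ k, ‖m k‖ ≤ B) {η : R3 → ℂ}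
    (hη : MemLp η 2 volume) (u : L2x) :
    fourierPairing η (kerConv m u)
      = fourierPairing (fun ξ => m ((2 * Real.pi) • ξ) * η ξ) u := by
  rw [fourierPairing_apply hη, fourierPairing_apply (memLp_symbol_mul hm hB hη), fourier_kerConv]
  refine integral_congr_ae
    ((coeFn_toL2 (memLp_symbol_mul hm hB (Lp.memLp (𝓕 u : L2x)))).mono fun ξ hξ => ?_)
  simp only [hξ]
  ring

lemma kerConv_const_mul (hm : Continuous m) {B : ℝ} (hB : ∀ k, ‖m k‖ ≤ B) (c : ℂ) (u : L2x) :
    kerConv (fun k => c * m k) u = c • kerConv m u := by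
  apply (Lp.fourierTransformₗᵢ R3 ℂ).injective
  rw [map_smul]
  change (𝓕 (kerConv (fun k => c * m k) u) : L2x) = c • (𝓕 (kerConv m u) : L2x)
  rw [fourier_kerConv, fourier_kerConv,
    toL2_eq_toLp (memLp_symbol_mul hm hB (Lp.memLp (𝓕 u : L2x))), ← MemLp.toLp_const_smul,
    ← toL2_eq_toLp]
  congr 1
  ext ξ
  simp [mul_assoc]

end Multiplier

/-- A family of symbols, continuous in the parameter and the frequency jointly and bounded in the
frequency locally uniformly in the parameter, acts on `L²` jointly continuously. -/
lemma continuous_kerConv {A : Type*} [TopologicalSpace A] [FirstCountableTopology A]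
    {m : A → R3 → ℂ} (hm : Continuous fun p : A × R3 => m p.1 p.2)
    (hB : ∀ a, ∃ B, ∀ᶠ b in nhds a, ∀ k, ‖m b k‖ ≤ B) :
    Continuous fun p : A × L2x => kerConv (m p.1) p.2 := by
  have hmc : ∀ a, Continuous (m a) := fun a => by fun_prop
  refine continuous_iff_continuousAt.2 fun ⟨a, u⟩ => ?_
  obtain ⟨B, hBe⟩ := hB a
  have hBa : ∀ k, ‖m a k‖ ≤ B := hBe.self_of_nhds
  have hB0 : 0 ≤ B := (norm_nonneg _).trans (hBa 0)
  -- strong continuity in the parameter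
  have hstrong : Filter.Tendsto (fun b => ‖kerConv (m b) u - kerConv (m a) u‖) (nhds a)
      (nhds 0) := by
    set û : L2x := 𝓕 u
    have hsq : Filter.Tendsto (fun b => ∫ ξ, ‖m b ((2 * Real.pi) • ξ) * û ξ
        - m a ((2 * Real.pi) • ξ) * û ξ‖ ^ 2) (nhds a) (nhds (∫ _ : R3, (0 : ℝ))) := by
      refine tendsto_integral_filter_of_dominated_convergence
        (fun ξ => (2 * B) ^ 2 * ‖û ξ‖ ^ 2) ?_ ?_ ?_ ?_
      · refine Filter.Eventually.of_forall fun b => ?_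
        have h1 : ∀ c, AEStronglyMeasurable (fun ξ => m c ((2 * Real.pi) • ξ) * û ξ) volume :=
          fun c => ((by fun_prop : Continuous fun ξ : R3 =>
            m c ((2 * Real.pi) • ξ)).aestronglyMeasurable).mul (Lp.aestronglyMeasurable _)
        exact (((h1 b).sub (h1 a)).norm.pow 2)
      · filter_upwards [hBe] with b hb
        refine Filter.Eventually.of_forall fun ξ => ?_
        rw [Real.norm_of_nonneg (by positivity), ← sub_mul, norm_mul, mul_pow]
        gcongr
        refine (norm_sub_le _ _).trans ?_
        linarith [hb ((2 * Real.pi) • ξ), hBa ((2 * Real.pi) • ξ)]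
      · exact ((memLp_two_iff_integrable_sq_norm (Lp.aestronglyMeasurable _)).1
          (Lp.memLp û)).const_mul _
      · refine Filter.Eventually.of_forall fun ξ => ?_
        have : Continuous fun b => ‖m b ((2 * Real.pi) • ξ) * û ξ
          - m a ((2 * Real.pi) • ξ) * û ξ‖ ^ 2 := by fun_prop
        simpa using this.tendsto a
    rw [integral_zero] at hsq
    have := hsq.sqrt
    rw [Real.sqrt_zero] at this
    refine this.congr' ?_
    filter_upwards [hBe] with b hb
    have hmb := memLp_symbol_mul (hmc b) hb (Lp.memLp û)
    have hma := memLp_symbol_mul (hmc a) hBa (Lp.memLp û)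
    have e : kerConv (m b) u - kerConv (m a) u = (𝓕⁻ (toL2 fun ξ =>
        m b ((2 * Real.pi) • ξ) * û ξ - m a ((2 * Real.pi) • ξ) * û ξ) : L2x) := by
      have h1 : toL2 (fun ξ => m b ((2 * Real.pi) • ξ) * û ξ - m a ((2 * Real.pi) • ξ) * û ξ)
          = toL2 (fun ξ => m b ((2 * Real.pi) • ξ) * û ξ)
            - toL2 (fun ξ => m a ((2 * Real.pi) • ξ) * û ξ) := by
        rw [toL2_eq_toLp hmb, toL2_eq_toLp hma, ← MemLp.toLp_sub, ← toL2_eq_toLp]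
        rfl
      rw [h1]
      exact (map_sub (Lp.fourierTransformₗᵢ R3 ℂ).symm _ _).symm
    have hsq := norm_toL2_sq (hmb.sub hma)
    simp only [Pi.sub_apply] at hsq
    rw [e, norm_fourierInv_L2, ← hsq, Real.sqrt_sq (norm_nonneg _)]
    rfl
  refine tendsto_iff_norm_sub_tendsto_zero.2 ?_
  have hfst : Filter.Tendsto (fun p : A × L2x => p.1) (nhds (a, u)) (nhds a) :=
    continuous_fst.tendsto _
  refine squeeze_zero' (g := fun p : A × L2x => B * ‖p.2 - u‖
    + ‖kerConv (m p.1) u - kerConv (m a) u‖) (Filter.Eventually.of_forall fun _ => norm_nonneg _)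
    ?_ ?_
  · filter_upwards [hfst.eventually hBe] with p hp
    have := norm_kerConv_le (hmc p.1) hp (p.2 - u)
    rw [kerConv_sub (hmc p.1) hp] at this
    refine (norm_sub_le_norm_sub_add_norm_sub _ (kerConv (m p.1) u) _).trans ?_
    gcongr
  · have h1 : Filter.Tendsto (fun p : A × L2x => B * ‖p.2 - u‖) (nhds (a, u)) (nhds 0) := by
      have : Continuous fun p : A × L2x => B * ‖p.2 - u‖ := by fun_prop
      simpa using this.tendsto (a, u)
    simpa using h1.add (hstrong.comp hfst)

lemma measurable_of_measurable_dist {A F : Type*} [MeasurableSpace A] [PseudoMetricSpace F]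
    [SecondCountableTopology F] [MeasurableSpace F] [BorelSpace F] {f : A → F}
    (h : ∀ u, Measurable fun a => dist (f a) u) : Measurable f := by
  refine measurable_of_isOpen fun U hU => ?_
  choose! r hr0 hr using fun u (hu : u ∈ U) => Metric.isOpen_iff.1 hU u hu
  obtain ⟨S, hSU, hSc, hS⟩ := TopologicalSpace.isOpen_biUnion_countable U
    (fun u => Metric.ball u (r u)) fun u _ => Metric.isOpen_ball
  have hUS : U = ⋃ u ∈ S, Metric.ball u (r u) := by
    rw [hS]
    exact subset_antisymm (fun u hu => mem_iUnion₂.2 ⟨u, hu, Metric.mem_ball_self (hr0 u hu)⟩)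
      (iUnion₂_subset hr)
  rw [hUS, preimage_iUnion₂]
  exact MeasurableSet.biUnion hSc fun u _ => measurableSet_lt (h u) measurable_const

/-- The `L²`-class of the slices of a jointly measurable function depends measurably on the
parameter: its distance to a fixed class is measurable by Tonelli's theorem. -/
lemma stronglyMeasurable_toL2 {A : Type*} [MeasurableSpace A] {g : A → R3 → ℂ}
    (hg : StronglyMeasurable fun p : A × R3 => g p.1 p.2) :
    StronglyMeasurable fun a => toL2 (g a) := by
  have hga : ∀ a, StronglyMeasurable (g a) := fun a =>
    hg.comp_measurable measurable_prodMk_left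
  have hnorm : ∀ h : A → R3 → ℂ, (StronglyMeasurable fun p : A × R3 => h p.1 p.2) →
      Measurable fun a => eLpNorm (h a) 2 volume := by
    intro h hh
    simp only [eLpNorm_eq_lintegral_rpow_enorm_toReal two_ne_zero ENNReal.ofNat_ne_top]
    exact ((hh.enorm.pow_const _).lintegral_prod_right').pow_const _
  have hmem : MeasurableSet {a | MemLp (g a) 2 volume} := by
    have : {a | MemLp (g a) 2 volume} = {a | eLpNorm (g a) 2 volume < ⊤} := by
      ext a
      exact ⟨fun h => h.2, fun h => ⟨(hga a).aestronglyMeasurable, h⟩⟩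
    rw [this]
    exact measurableSet_lt (hnorm g hg) measurable_const
  borelize ↥L2x
  have hfact : Fact ((2 : ENNReal) ≠ ⊤) := ⟨ENNReal.ofNat_ne_top⟩
  refine (measurable_of_measurable_dist fun u => ?_).stronglyMeasurable
  classical
  have hu : StronglyMeasurable fun p : A × R3 => g p.1 p.2 - u p.2 :=
    hg.sub ((Lp.stronglyMeasurable u).comp_measurable measurable_snd)
  have hite : (fun a => dist (toL2 (g a)) u) = fun a =>
      if MemLp (g a) 2 volume then (eLpNorm (fun x => g a x - u x) 2 volume).toReal
      else ‖u‖ := by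
    ext a
    by_cases ha : MemLp (g a) 2 volume
    · rw [if_pos ha, dist_eq_norm, toL2_eq_toLp ha]
      conv_lhs => rw [← Lp.toLp_coeFn u (Lp.memLp u), ← MemLp.toLp_sub, Lp.norm_toLp]
      rfl
    · rw [if_neg ha]
      simp [toL2, ha]
  rw [hite]
  exact Measurable.ite hmem (hnorm _ hu).ennreal_toReal measurable_const

/-! ### The symbols -/

lemma bracket_le_one_add_norm (y : R3) : bracket y ≤ 1 + ‖y‖ := by
  rw [bracket, Real.sqrt_le_left (by positivity)]
  nlinarith [norm_nonneg y]

lemma one_sub_norm_hatv_ge (v : R3) : 1 / (2 * bracket v ^ 2) ≤ 1 - ‖hatv v‖ := by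
  have hb := bracket_pos v
  have h1 := bracket_sq v
  have h2 := norm_le_bracket v
  have h3 : 1 ≤ 2 * bracket v * (bracket v - ‖v‖) := by nlinarith [norm_nonneg v]
  rw [norm_hatv, div_le_iff₀ (by positivity)]
  calc 1 ≤ 2 * bracket v * (bracket v - ‖v‖) := h3
    _ = (1 - (bracket v)⁻¹ * ‖v‖) * (2 * bracket v ^ 2) := by field_simp

lemma abs_inner_hatv_le (k v : R3) : |inner ℝ k (hatv v)| ≤ bracket k * ‖hatv v‖ :=
  (abs_real_inner_le_norm _ _).trans
    (mul_le_mul_of_nonneg_right (norm_le_bracket k) (norm_nonneg _))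

lemma norm_intUnit_cast (σ : ℤˣ) : ‖((σ : ℤ) : ℂ)‖ = 1 := by
  rcases Int.units_eq_one_or σ with rfl | rfl <;> simp

/-- The phase `λ_±(k) + i k · v̂` does not vanish: massive waves travel faster than particles. -/
lemma le_norm_phase (σ : ℤˣ) (v k : R3) :
    bracket k / (2 * bracket v ^ 2)
      ≤ ‖lam σ k + Complex.I * ((inner ℝ k (hatv v) : ℝ) : ℂ)‖ := by
  have h1 : ‖lam σ k‖ = bracket k := by
    rw [lam, norm_mul, norm_mul, norm_intUnit_cast, Complex.norm_I, one_mul, one_mul,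
      Complex.norm_real, Real.norm_of_nonneg (bracket_pos k).le]
  have h2 : ‖Complex.I * ((inner ℝ k (hatv v) : ℝ) : ℂ)‖ ≤ bracket k * ‖hatv v‖ := by
    rw [norm_mul, Complex.norm_I, one_mul, Complex.norm_real]
    exact abs_inner_hatv_le k v
  have h3 := norm_sub_le_norm_add (lam σ k) (Complex.I * ((inner ℝ k (hatv v) : ℝ) : ℂ))
  have h4 := mul_le_mul_of_nonneg_left (one_sub_norm_hatv_ge v) (bracket_pos k).le
  rw [mul_one_div] at h4
  linarith

lemma phase_ne_zero (σ : ℤˣ) (v k : R3) :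
    lam σ k + Complex.I * ((inner ℝ k (hatv v) : ℝ) : ℂ) ≠ 0 := by
  rw [← norm_pos_iff]
  have := bracket_pos v
  have := bracket_pos k
  exact lt_of_lt_of_le (by positivity) (le_norm_phase σ v k)

lemma norm_phiSymb_le (σ : ℤˣ) (v k : R3) :
    ‖phiSymb σ v k‖ ≤ 2 * bracket v ^ 2 / bracket k := by
  have hv := bracket_pos v
  have hk := bracket_pos k
  rw [phiSymb, norm_inv, ← inv_div]
  exact inv_anti₀ (by positivity) (le_norm_phase σ v k)

lemma contDiff_lam (σ : ℤˣ) : ContDiff ℝ 1 (lam σ) :=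
  contDiff_const.mul (Complex.ofRealCLM.contDiff.comp contDiff_bracket)

lemma contDiff_phiSymb (σ : ℤˣ) : ContDiff ℝ 1 fun p : R3 × R3 => phiSymb σ p.1 p.2 := by
  refine ContDiff.inv ?_ fun p => phase_ne_zero σ p.1 p.2
  refine ((contDiff_lam σ).comp contDiff_snd).add (contDiff_const.mul
    (Complex.ofRealCLM.contDiff.comp (contDiff_snd.inner ℝ (contDiff_hatv.comp contDiff_fst))))

lemma continuous_lam (σ : ℤˣ) : Continuous (lam σ) := (contDiff_lam σ).continuous

lemma continuous_aSymb (σ : ℤˣ) : Continuous (aSymb σ) :=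
  continuous_const.mul ((Complex.continuous_ofReal.comp
    (contDiff_bracket (n := 0)).continuous).inv₀ fun k => by
      simpa using (bracket_pos k).ne')

lemma continuous_GSymb (σ : ℤˣ) : Continuous fun p : ℝ × R3 => GSymb σ p.1 p.2 := by
  have := continuous_lam σ
  have := continuous_aSymb σ
  unfold GSymb
  fun_prop

lemma GSymb_zero (σ : ℤˣ) : GSymb σ 0 = aSymb σ := by
  ext k
  simp [GSymb]

lemma norm_GSymb_le (σ : ℤˣ) (t : ℝ) (k : R3) : ‖GSymb σ t k‖ ≤ 1 := by
  have h1 : lam σ k * (t : ℂ) = ((((σ : ℤ) : ℝ) * bracket k * t : ℝ) : ℂ) * Complex.I := by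
    simp only [lam]
    push_cast
    ring
  rw [GSymb, norm_mul, h1, Complex.norm_exp_ofReal_mul_I, one_mul, aSymb]
  have hb := bracket_pos k
  rw [norm_mul, norm_mul, norm_neg, norm_intUnit_cast, norm_inv, Complex.norm_real,
    Real.norm_of_nonneg hb.le, norm_div, Complex.norm_I]
  have := inv_le_one_of_one_le₀ (one_le_bracket k)
  have := inv_nonneg.2 hb.le
  norm_num
  linarith

lemma hasDerivAt_GSymb (σ : ℤˣ) (t τ : ℝ) (k : R3) :
    HasDerivAt (fun s : ℝ => GSymb σ (t - s) k) (-(lam σ k * GSymb σ (t - τ) k)) τ := by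
  have h1 : HasDerivAt (fun s : ℝ => lam σ k * ((t - s : ℝ) : ℂ)) (lam σ k * (-1 : ℝ)) τ :=
    (((hasDerivAt_id τ).const_sub t).ofReal_comp).const_mul _
  have h2 := (h1.cexp).mul_const (aSymb σ k)
  refine h2.congr_deriv ?_
  rw [GSymb]
  push_cast
  ring

/-- A family of symbols parametrized by the velocity, jointly continuous, and bounded in the
frequency uniformly for bounded velocities. -/
structure IsVelocitySymbol (m : R3 → R3 → ℂ) : Prop where
  continuous : Continuous fun p : R3 × R3 => m p.1 p.2
  exists_bound : ∀ r : ℝ, ∃ B, ∀ v, ‖v‖ ≤ r → ∀ k, ‖m v k‖ ≤ B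

section Weight

variable {φ : R3 → ℝ}

lemma exists_abs_le_of_continuous (hφ : Continuous φ) (r : ℝ) :
    ∃ B, 0 ≤ B ∧ ∀ v, ‖v‖ ≤ r → |φ v| ≤ B := by
  obtain ⟨B, hB⟩ := (isCompact_closedBall (0 : R3) r).exists_bound_of_continuousOn hφ.continuousOn
  exact ⟨max B 0, le_max_right _ _, fun v hv =>
    (hB v (mem_closedBall_zero_iff.2 hv)).trans (le_max_left _ _)⟩

lemma isVelocitySymbol_weight (hφ : Continuous φ) :
    IsVelocitySymbol fun v _ => (φ v : ℂ) := by
  refine ⟨by fun_prop, fun r => ?_⟩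
  obtain ⟨B, -, hB⟩ := exists_abs_le_of_continuous hφ r
  exact ⟨B, fun v hv _ => by simpa using hB v hv⟩

lemma norm_phiSymb_le_of_norm_le (σ : ℤˣ) {r : ℝ} {v : R3} (hv : ‖v‖ ≤ r) (k : R3) :
    ‖phiSymb σ v k‖ ≤ 2 * (1 + r) ^ 2 / bracket k := by
  have := bracket_pos k
  have := bracket_pos v
  refine (norm_phiSymb_le σ v k).trans ?_
  gcongr
  exact (bracket_le_one_add_norm v).trans (by linarith)

lemma norm_phiSymb_le_of_norm_le' (σ : ℤˣ) {r : ℝ} {v : R3} (hv : ‖v‖ ≤ r) (k : R3) :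
    ‖phiSymb σ v k‖ ≤ 2 * (1 + r) ^ 2 :=
  (norm_phiSymb_le_of_norm_le σ hv k).trans (div_le_self (by positivity) (one_le_bracket k))

lemma isVelocitySymbol_phiSymb_mul (σ : ℤˣ) (hφ : Continuous φ) :
    IsVelocitySymbol fun v k => (φ v : ℂ) * phiSymb σ v k := by
  refine ⟨?_, fun r => ?_⟩
  · have := (contDiff_phiSymb σ).continuous
    fun_prop
  · obtain ⟨B, hB0, hB⟩ := exists_abs_le_of_continuous hφ r
    refine ⟨B * (2 * (1 + r) ^ 2), fun v hv k => ?_⟩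
    rw [norm_mul, Complex.norm_real]
    exact mul_le_mul (hB v hv) (norm_phiSymb_le_of_norm_le' σ hv k) (norm_nonneg _) hB0

/-- The velocity derivative of `1 / (λ_± + i k · v̂)` brings down a factor `k`, which is absorbed
by the second power of the denominator. -/
lemma norm_fderiv_phiSymb_le (σ : ℤˣ) {r : ℝ} {v : R3} (hv : ‖v‖ ≤ r) (k : R3) :
    ‖fderiv ℝ (fun w => phiSymb σ w k) v‖ ≤ (2 * (2 + r) ^ 2) ^ 2 * 2 := by
  refine norm_fderiv_le_of_lip' ℝ (by positivity) ?_
  filter_upwards [Metric.ball_mem_nhds v one_pos] with w hw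
  rw [mem_ball_iff_norm] at hw
  have hw' : ‖w‖ ≤ r + 1 := by
    have := norm_le_norm_add_norm_sub' w v
    linarith
  have hv' : ‖v‖ ≤ r + 1 := by linarith
  have hk := bracket_pos k
  have e : phiSymb σ w k - phiSymb σ v k = phiSymb σ w k * phiSymb σ v k
      * (Complex.I * ((inner ℝ k (hatv v - hatv w) : ℝ) : ℂ)) := by
    have h1 := phase_ne_zero σ w k
    have h2 := phase_ne_zero σ v k
    rw [inner_sub_right]
    simp only [phiSymb]
    push_cast
    field_simp
    ring
  have h3 : |inner ℝ k (hatv v - hatv w)| ≤ bracket k * (2 * ‖w - v‖) := by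
    refine (abs_real_inner_le_norm _ _).trans ?_
    have := lipschitzWith_hatv.dist_le_mul v w
    rw [dist_eq_norm, dist_eq_norm, norm_sub_rev v w] at this
    push_cast at this
    gcongr
    exact norm_le_bracket k
  rw [e, norm_mul, norm_mul, norm_mul, Complex.norm_I, one_mul, Complex.norm_real]
  have hr : (1 : ℝ) + (r + 1) = 2 + r := by ring
  have h1 := norm_phiSymb_le_of_norm_le σ hw' k
  have h2 := norm_phiSymb_le_of_norm_le σ hv' k
  rw [hr] at h1 h2
  calc ‖phiSymb σ w k‖ * ‖phiSymb σ v k‖ * |inner ℝ k (hatv v - hatv w)|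
      ≤ (2 * (2 + r) ^ 2 / bracket k) * (2 * (2 + r) ^ 2 / bracket k)
        * (bracket k * (2 * ‖w - v‖)) := by gcongr
    _ = (2 * (2 + r) ^ 2) ^ 2 * 2 * ‖w - v‖ / bracket k := by field_simp
    _ ≤ _ := div_le_self (by positivity) (one_le_bracket k)

lemma contDiff_phiSymb_mul_weight (σ : ℤˣ) (hφ : ContDiff ℝ 1 φ) :
    ContDiff ℝ 1 fun p : R3 × R3 => phiSymb σ p.1 p.2 * ((φ p.1 : ℝ) : ℂ) :=
  (contDiff_phiSymb σ).mul (Complex.ofRealCLM.contDiff.comp (hφ.comp contDiff_fst))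

lemma isVelocitySymbol_gradPhiSymb (σ : ℤˣ) (hφ : ContDiff ℝ 1 φ) (j : Fin 3) :
    IsVelocitySymbol (gradPhiSymb σ φ j) := by
  refine ⟨?_, fun r => ?_⟩
  · have huncurry : ContDiff ℝ 1 (Function.uncurry fun (p : R3 × R3) (w : R3) =>
        phiSymb σ w p.2 * ((φ w : ℝ) : ℂ)) :=
      (contDiff_phiSymb_mul_weight σ hφ).comp (f := fun q : (R3 × R3) × R3 => (q.2, q.1.2))
        (contDiff_snd.prodMk (contDiff_snd.comp contDiff_fst))
    have h := ContDiff.fderiv (n := 0) (g := fun p : R3 × R3 => p.1) huncurry contDiff_fst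
      (by simp)
    exact h.continuous.clm_apply continuous_const
  · obtain ⟨B, hB0, hB⟩ := exists_abs_le_of_continuous hφ.continuous r
    obtain ⟨B', hB'⟩ := (isCompact_closedBall (0 : R3) r).exists_bound_of_continuousOn
      (hφ.continuous_fderiv one_ne_zero).continuousOn
    refine ⟨2 * (1 + r) ^ 2 * B' + B * ((2 * (2 + r) ^ 2) ^ 2 * 2), fun v hv k => ?_⟩
    have hd1 : DifferentiableAt ℝ (fun w => phiSymb σ w k) v :=
      (((contDiff_phiSymb σ).comp (contDiff_id.prodMk contDiff_const)).differentiable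
        one_ne_zero) v
    have hd2 := (hφ.differentiable one_ne_zero v).hasFDerivAt
    have hd3 : HasFDerivAt (fun w => ((φ w : ℝ) : ℂ))
        (Complex.ofRealCLM.comp (fderiv ℝ φ v)) v := Complex.ofRealCLM.hasFDerivAt.comp v hd2
    have hd4 : fderiv ℝ (fun w => phiSymb σ w k * ((φ w : ℝ) : ℂ)) v = _ :=
      (hd1.hasFDerivAt.mul hd3).fderiv
    rw [gradPhiSymb, hd4]
    refine (ContinuousLinearMap.le_opNorm _ _).trans ?_
    rw [PiLp.norm_single, norm_one, mul_one]
    refine (norm_add_le _ _).trans (add_le_add ?_ ?_)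
    · rw [norm_smul]
      refine mul_le_mul (norm_phiSymb_le_of_norm_le' σ hv k) ?_ (norm_nonneg _) (by positivity)
      refine (ContinuousLinearMap.opNorm_comp_le _ _).trans ?_
      rw [Complex.ofRealCLM_norm, one_mul]
      exact hB' v (mem_closedBall_zero_iff.2 hv)
    · rw [norm_smul, Complex.norm_real]
      exact mul_le_mul (hB v hv) (norm_fderiv_phiSymb_le σ hv k) (norm_nonneg _) hB0

end Weight

/-! ### Velocity integrals of Fourier multipliers -/

/-- A square integrable, jointly measurable function on phase space that vanishes for velocities
larger than `r`. -/
structure IsPhaseDensity (r : ℝ) (g : R3 → R3 → ℂ) : Prop where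
  stronglyMeasurable : StronglyMeasurable fun p : R3 × R3 => g p.1 p.2
  memLp : MemLp (fun p : R3 × R3 => g p.1 p.2) 2 volume
  eq_zero : ∀ x v, r < ‖v‖ → g x v = 0

/-- The velocity integral `∫ m(·, v) ⋆_x g(·, v) dv`, with values in `L²_x`, of a velocity
dependent Fourier multiplier. -/
noncomputable def kineticIntegral (m : R3 → R3 → ℂ) (g : R3 → R3 → ℂ) : L2x :=
  ∫ v, kerConv (m v) (toL2 fun x => g x v)

namespace IsPhaseDensity

variable {r : ℝ} {g : R3 → R3 → ℂ}

lemma integrable_norm_sq (hg : IsPhaseDensity r g) :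
    Integrable fun p : R3 × R3 => ‖g p.1 p.2‖ ^ 2 :=
  (memLp_two_iff_integrable_sq_norm hg.memLp.1).1 hg.memLp

lemma memLp_slice (hg : IsPhaseDensity r g) : ∀ᵐ v : R3, MemLp (fun x => g x v) 2 volume := by
  filter_upwards [hg.integrable_norm_sq.prod_left_ae] with v hv
  exact (memLp_two_iff_integrable_sq_norm (hg.stronglyMeasurable.comp_measurable
    measurable_prodMk_right).aestronglyMeasurable).2 hv

lemma stronglyMeasurable_toL2 (hg : IsPhaseDensity r g) :
    StronglyMeasurable fun v => toL2 fun x => g x v :=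
  VKG.stronglyMeasurable_toL2 (g := fun v x => g x v)
    (hg.stronglyMeasurable.comp_measurable measurable_swap)

lemma toL2_eq_zero (hg : IsPhaseDensity r g) {v : R3} (hv : r < ‖v‖) :
    (toL2 fun x => g x v) = 0 := by
  simp only [hg.eq_zero _ v hv, toL2_zero]

lemma norm_toL2_sq_ae (hg : IsPhaseDensity r g) :
    (fun v => ‖toL2 fun x => g x v‖ ^ 2) =ᵐ[volume] fun v => ∫ x, ‖g x v‖ ^ 2 :=
  hg.memLp_slice.mono fun _ hv => norm_toL2_sq hv

lemma integrable_norm_toL2_sq (hg : IsPhaseDensity r g) :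
    Integrable fun v => ‖toL2 fun x => g x v‖ ^ 2 :=
  hg.integrable_norm_sq.integral_prod_right.congr hg.norm_toL2_sq_ae.symm

lemma integral_norm_toL2_sq (hg : IsPhaseDensity r g) :
    ∫ v, ‖toL2 fun x => g x v‖ ^ 2 = ∫ p : R3 × R3, ‖g p.1 p.2‖ ^ 2 := by
  rw [integral_congr_ae hg.norm_toL2_sq_ae]
  exact (integral_prod_symm _ hg.integrable_norm_sq).symm

end IsPhaseDensity

section KineticIntegral

variable {r : ℝ} {g m : R3 → R3 → ℂ}

lemma IsVelocitySymbol.continuous_slice (hm : IsVelocitySymbol m) (v : R3) : Continuous (m v) := by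
  have := hm.continuous
  fun_prop

lemma IsVelocitySymbol.continuous_kerConv (hm : IsVelocitySymbol m) :
    Continuous fun p : R3 × L2x => kerConv (m p.1) p.2 := by
  refine VKG.continuous_kerConv hm.continuous fun v => ?_
  obtain ⟨B, hB⟩ := hm.exists_bound (‖v‖ + 1)
  refine ⟨B, ?_⟩
  filter_upwards [Metric.ball_mem_nhds v one_pos] with w hw
  refine hB w ?_
  rw [mem_ball_iff_norm] at hw
  have := norm_le_norm_add_norm_sub' w v
  linarith

lemma norm_kerConv_toL2_le (hm : IsVelocitySymbol m) (hg : IsPhaseDensity r g) {B : ℝ}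
    (hB : ∀ v, ‖v‖ ≤ r → ∀ k, ‖m v k‖ ≤ B) (v : R3) :
    ‖kerConv (m v) (toL2 fun x => g x v)‖ ≤ (Metric.closedBall (0 : R3) r).indicator
      (fun v => B * (1 + ‖toL2 fun x => g x v‖ ^ 2)) v := by
  by_cases hv : ‖v‖ ≤ r
  · rw [indicator_of_mem (mem_closedBall_zero_iff.2 hv)]
    have hB0 : 0 ≤ B := (norm_nonneg _).trans (hB v hv 0)
    refine (norm_kerConv_le (hm.continuous_slice v) (hB v hv) _).trans ?_
    gcongr
    nlinarith [sq_nonneg (‖toL2 fun x => g x v‖ - 1)]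
  · rw [hg.toL2_eq_zero (not_le.1 hv), kerConv_zero, norm_zero,
      indicator_of_notMem (by simpa using hv)]

lemma integrable_norm_bound (hg : IsPhaseDensity r g) (B : ℝ) :
    Integrable ((Metric.closedBall (0 : R3) r).indicator
      fun v => B * (1 + ‖toL2 fun x => g x v‖ ^ 2)) := by
  refine (integrable_indicator_iff Metric.isClosed_closedBall.measurableSet).2 ?_
  exact ((integrableOn_const (isCompact_closedBall _ _).measure_lt_top.ne).add
    hg.integrable_norm_toL2_sq.integrableOn).const_mul B

lemma integrable_kerConv_toL2 (hm : IsVelocitySymbol m) (hg : IsPhaseDensity r g) :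
    Integrable fun v => kerConv (m v) (toL2 fun x => g x v) := by
  obtain ⟨B, hB⟩ := hm.exists_bound r
  refine (integrable_norm_bound hg B).mono' ?_
    (Filter.Eventually.of_forall (norm_kerConv_toL2_le hm hg hB))
  exact (hm.continuous_kerConv.comp_stronglyMeasurable
    (stronglyMeasurable_id.prodMk hg.stronglyMeasurable_toL2)).aestronglyMeasurable

lemma norm_kineticIntegral_le (hm : IsVelocitySymbol m) (hg : IsPhaseDensity r g) {B : ℝ}
    (hB0 : 0 ≤ B) (hB : ∀ v, ‖v‖ ≤ r → ∀ k, ‖m v k‖ ≤ B) :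
    ‖kineticIntegral m g‖ ≤ B * (volume.real (Metric.closedBall (0 : R3) r)
      + ∫ p : R3 × R3, ‖g p.1 p.2‖ ^ 2) := by
  refine (norm_integral_le_of_norm_le (integrable_norm_bound hg B)
    (Filter.Eventually.of_forall (norm_kerConv_toL2_le hm hg hB))).trans ?_
  have hc : IntegrableOn (fun _ : R3 => (1 : ℝ)) (Metric.closedBall (0 : R3) r) :=
    integrableOn_const (isCompact_closedBall _ _).measure_lt_top.ne
  rw [integral_indicator Metric.isClosed_closedBall.measurableSet, integral_const_mul,
    integral_add hc hg.integrable_norm_toL2_sq.integrableOn, setIntegral_const, smul_eq_mul,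
    mul_one, ← hg.integral_norm_toL2_sq]
  exact mul_le_mul_of_nonneg_left (add_le_add le_rfl
    (setIntegral_le_integral hg.integrable_norm_toL2_sq
      (Filter.Eventually.of_forall fun v => sq_nonneg _))) hB0

/-! ### Testing velocity integrals against frequency cut-offs -/

lemma stronglyMeasurable_fourier {A : Type*} [TopologicalSpace A] [MeasurableSpace A]
    [BorelSpace A] [SecondCountableTopology A] {n : A → R3 → ℂ}
    (hn : Continuous fun p : A × R3 => n p.1 p.2) :
    StronglyMeasurable fun p : A × R3 => 𝓕 (n p.1) p.2 := by
  simp only [Real.fourier_eq']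
  have hc : Continuous fun q : (A × R3) × R3 =>
      Complex.exp (((-2 * Real.pi * inner ℝ q.2 q.1.2 : ℝ) : ℂ) * Complex.I) • n q.1.1 q.2 := by
    fun_prop
  exact hc.stronglyMeasurable.integral_prod_right'

variable {η : R3 → ℂ}

lemma continuous_symbol_mul {m η : R3 → ℂ} (hm : Continuous m) (hη : Continuous η) :
    Continuous fun ξ => m ((2 * Real.pi) • ξ) * η ξ := by fun_prop

lemma integral_norm_symbol_mul_sq_le {m η : R3 → ℂ} (hm : Continuous m) {B : ℝ}
    (hB : ∀ k, ‖m k‖ ≤ B) (hη : Continuous η) (hηs : HasCompactSupport η) :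
    ∫ ξ, ‖m ((2 * Real.pi) • ξ) * η ξ‖ ^ 2 ≤ B ^ 2 * ∫ ξ, ‖η ξ‖ ^ 2 := by
  have h2 := hη.memLp_of_hasCompactSupport hηs (p := 2) (μ := volume)
  rw [← integral_const_mul]
  refine integral_mono
    ((memLp_two_iff_integrable_sq_norm (memLp_symbol_mul hm hB h2).1).1
      (memLp_symbol_mul hm hB h2))
    (((memLp_two_iff_integrable_sq_norm h2.1).1 h2).const_mul _) fun ξ => ?_
  simp only [norm_mul, mul_pow]
  gcongr
  exact hB _

/-- The majorant of `𝓕[m(v) η](x) g(x, v)`, as a function on phase space. -/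
noncomputable def pairingMajorant (r : ℝ) (m g : R3 → R3 → ℂ) (η : R3 → ℂ) (p : R3 × R3) : ℝ :=
  (Metric.closedBall (0 : R3) r).indicator (fun v =>
    ‖𝓕 (fun ξ => m v ((2 * Real.pi) • ξ) * η ξ) p.1‖ ^ 2) p.2 + ‖g p.1 p.2‖ ^ 2

lemma norm_fourier_mul_le_majorant (hg : IsPhaseDensity r g) (p : R3 × R3) :
    ‖𝓕 (fun ξ => m p.2 ((2 * Real.pi) • ξ) * η ξ) p.1 * g p.1 p.2‖
      ≤ pairingMajorant r m g η p := by
  unfold pairingMajorant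
  by_cases hv : ‖p.2‖ ≤ r
  · rw [indicator_of_mem (mem_closedBall_zero_iff.2 hv), norm_mul]
    nlinarith [sq_nonneg (‖𝓕 (fun ξ => m p.2 ((2 * Real.pi) • ξ) * η ξ) p.1‖ - ‖g p.1 p.2‖),
      sq_nonneg (‖𝓕 (fun ξ => m p.2 ((2 * Real.pi) • ξ) * η ξ) p.1‖), sq_nonneg ‖g p.1 p.2‖]
  · rw [hg.eq_zero _ _ (not_le.1 hv), mul_zero, norm_zero]
    refine add_nonneg (indicator_nonneg (fun _ _ => by positivity) _) (by positivity)

lemma stronglyMeasurable_fourier_symbol (hm : IsVelocitySymbol m) (hη : Continuous η) :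
    StronglyMeasurable fun p : R3 × R3 =>
      𝓕 (fun ξ => m p.2 ((2 * Real.pi) • ξ) * η ξ) p.1 := by
  have hmc := hm.continuous
  have hn : Continuous fun q : R3 × R3 => m q.1 ((2 * Real.pi) • q.2) * η q.2 := by
    fun_prop
  exact StronglyMeasurable.comp_measurable (g := (Prod.swap : R3 × R3 → R3 × R3))
    (stronglyMeasurable_fourier (n := fun v ξ => m v ((2 * Real.pi) • ξ) * η ξ) hn)
    measurable_swap

lemma integrable_pairingMajorant (hm : IsVelocitySymbol m) (hg : IsPhaseDensity r g) {B : ℝ}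
    (hB : ∀ v, ‖v‖ ≤ r → ∀ k, ‖m v k‖ ≤ B) (hη : Continuous η) (hηs : HasCompactSupport η) :
    Integrable (pairingMajorant r m g η) ∧ ∫ p, pairingMajorant r m g η p
      ≤ volume.real (Metric.closedBall (0 : R3) r) * (B ^ 2 * ∫ ξ, ‖η ξ‖ ^ 2)
        + ∫ p : R3 × R3, ‖g p.1 p.2‖ ^ 2 := by
  set Q := Metric.closedBall (0 : R3) r
  have hQ : MeasurableSet Q := Metric.isClosed_closedBall.measurableSet
  set F : R3 × R3 → ℝ := fun p => Q.indicator (fun v =>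
    ‖𝓕 (fun ξ => m v ((2 * Real.pi) • ξ) * η ξ) p.1‖ ^ 2) p.2
  have hF0 : ∀ p, 0 ≤ F p := fun p => indicator_nonneg (fun _ _ => by positivity) _
  have hFm : StronglyMeasurable F := by
    have h1 := ((stronglyMeasurable_fourier_symbol hm hη).norm.pow 2).indicator
      (hQ.preimage measurable_snd)
    exact h1
  have hslice : ∀ v, Integrable (fun ξ => m v ((2 * Real.pi) • ξ) * η ξ) ∧
      MemLp (fun ξ => m v ((2 * Real.pi) • ξ) * η ξ) 2 volume := fun v => by
    have h1 := continuous_symbol_mul (hm.continuous_slice v) hη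
    exact ⟨h1.integrable_of_hasCompactSupport hηs.mul_left,
      h1.memLp_of_hasCompactSupport hηs.mul_left⟩
  have hFi : ∀ v, Integrable fun x => F (x, v) := fun v => by
    by_cases hv : v ∈ Q
    · simp only [F, indicator_of_mem hv]
      have := memLp_fourier (hslice v).1 (hslice v).2
      exact (memLp_two_iff_integrable_sq_norm this.1).1 this
    · simp only [F, indicator_of_notMem hv]
      exact integrable_zero _ _ _
  have hFb : ∀ v, ∫ x, F (x, v) ≤ Q.indicator (fun _ => B ^ 2 * ∫ ξ, ‖η ξ‖ ^ 2) v := fun v => by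
    by_cases hv : v ∈ Q
    · simp only [F, indicator_of_mem hv]
      rw [integral_norm_fourier_sq (hslice v).1 (hslice v).2]
      exact integral_norm_symbol_mul_sq_le (hm.continuous_slice v)
        (hB v (mem_closedBall_zero_iff.1 hv)) hη hηs
    · simp [F, indicator_of_notMem hv]
  have hbi : Integrable (Q.indicator fun _ => B ^ 2 * ∫ ξ, ‖η ξ‖ ^ 2) :=
    (integrable_indicator_iff hQ).2
      (integrableOn_const (isCompact_closedBall _ _).measure_lt_top.ne)
  have hFint : Integrable F := by
    refine (integrable_prod_iff' hFm.aestronglyMeasurable).2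
      ⟨Filter.Eventually.of_forall hFi, hbi.mono' ?_ (Filter.Eventually.of_forall fun v => ?_)⟩
    · exact (hFm.norm.integral_prod_left').aestronglyMeasurable
    · rw [Real.norm_of_nonneg (integral_nonneg fun _ => norm_nonneg _)]
      simp only [Real.norm_of_nonneg (hF0 _)]
      exact hFb v
  refine ⟨hFint.add hg.integrable_norm_sq, ?_⟩
  have h1 : ∫ p, pairingMajorant r m g η p = (∫ p, F p) + ∫ p : R3 × R3, ‖g p.1 p.2‖ ^ 2 :=
    integral_add hFint hg.integrable_norm_sq
  have h2 : ∫ p, F p = ∫ v, ∫ x, F (x, v) := integral_prod_symm _ hFint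
  rw [h1, h2]
  gcongr
  refine (integral_mono hFint.integral_prod_right hbi hFb).trans ?_
  rw [integral_indicator hQ, setIntegral_const, smul_eq_mul]

lemma integrable_fourier_mul (hm : IsVelocitySymbol m) (hg : IsPhaseDensity r g)
    (hη : Continuous η) (hηs : HasCompactSupport η) :
    Integrable fun p : R3 × R3 =>
      𝓕 (fun ξ => m p.2 ((2 * Real.pi) • ξ) * η ξ) p.1 * g p.1 p.2 := by
  obtain ⟨B, hB⟩ := hm.exists_bound r
  exact (integrable_pairingMajorant hm hg hB hη hηs).1.mono'
    ((stronglyMeasurable_fourier_symbol hm hη).mul hg.stronglyMeasurable).aestronglyMeasurable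
    (Filter.Eventually.of_forall (norm_fourier_mul_le_majorant hg))

lemma integral_norm_fourier_mul_le (hm : IsVelocitySymbol m) (hg : IsPhaseDensity r g) {B : ℝ}
    (hB : ∀ v, ‖v‖ ≤ r → ∀ k, ‖m v k‖ ≤ B) (hη : Continuous η) (hηs : HasCompactSupport η) :
    ∫ p : R3 × R3, ‖𝓕 (fun ξ => m p.2 ((2 * Real.pi) • ξ) * η ξ) p.1 * g p.1 p.2‖
      ≤ volume.real (Metric.closedBall (0 : R3) r) * (B ^ 2 * ∫ ξ, ‖η ξ‖ ^ 2)
        + ∫ p : R3 × R3, ‖g p.1 p.2‖ ^ 2 :=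
  (integral_mono (integrable_fourier_mul hm hg hη hηs).norm
    (integrable_pairingMajorant hm hg hB hη hηs).1 (norm_fourier_mul_le_majorant hg)).trans
    (integrable_pairingMajorant hm hg hB hη hηs).2

/-- Tested against a frequency cut-off `η`, a velocity integral becomes an absolutely convergent
integral over phase space. -/
lemma fourierPairing_kineticIntegral (hm : IsVelocitySymbol m) (hg : IsPhaseDensity r g)
    (hη : Continuous η) (hηs : HasCompactSupport η) :
    fourierPairing η (kineticIntegral m g) = ∫ p : R3 × R3,
      𝓕 (fun ξ => m p.2 ((2 * Real.pi) • ξ) * η ξ) p.1 * g p.1 p.2 := by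
  have h2 := hη.memLp_of_hasCompactSupport hηs (p := 2) (μ := volume)
  have hswap := integral_prod_symm _ (integrable_fourier_mul hm hg hη hηs)
  rw [kineticIntegral, ← ContinuousLinearMap.integral_comp_comm _ (integrable_kerConv_toL2 hm hg)]
  refine Eq.trans (integral_congr_ae ?_) hswap.symm
  obtain ⟨B, hB⟩ := hm.exists_bound r
  filter_upwards [hg.memLp_slice] with v hv
  by_cases hvr : ‖v‖ ≤ r
  · have h1 := continuous_symbol_mul (hm.continuous_slice v) hη
    rw [fourierPairing_kerConv (hm.continuous_slice v) (hB v hvr) h2,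
      fourierPairing_eq_integral_fourier (h1.integrable_of_hasCompactSupport hηs.mul_left)
        (h1.memLp_of_hasCompactSupport hηs.mul_left)]
    exact integral_congr_ae ((coeFn_toL2 hv).mono fun x hx => by simp only [hx])
  · simp [kerConv_zero, hg.eq_zero _ v (not_le.1 hvr)]

end KineticIntegral

/-! ### The velocity averages of the theorem as velocity integrals of multipliers -/

section Source

variable {r : ℝ} {f : R3 → R3 → ℝ} {φ : R3 → ℝ}

lemma source_eq_integral (φ : R3 → ℝ) (f : R3 → R3 → ℝ) (x : R3) :
    ((source φ f x : ℝ) : ℂ) = ∫ v, (φ v : ℂ) * (f x v : ℂ) := by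
  have h : ∫ v, ((f x v * φ v : ℝ) : ℂ) = ((∫ v, f x v * φ v : ℝ) : ℂ) := integral_ofReal
  rw [source, ← h]
  simp only [Complex.ofReal_mul, mul_comm]

lemma ae_integrable_mul_weight (hf : IsPhaseDensity r fun x v => (f x v : ℂ))
    (hφ : Continuous φ) : ∀ᵐ x : R3, Integrable fun v => f x v * φ v := by
  obtain ⟨B, hB0, hB⟩ := exists_abs_le_of_continuous hφ r
  have hre : StronglyMeasurable fun p : R3 × R3 => f p.1 p.2 :=
    Complex.continuous_re.comp_stronglyMeasurable hf.stronglyMeasurable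
  filter_upwards [hf.integrable_norm_sq.prod_right_ae] with x hx
  have hbound : Integrable ((Metric.closedBall (0 : R3) r).indicator
      fun v => B * (1 + ‖(f x v : ℂ)‖ ^ 2)) :=
    (integrable_indicator_iff Metric.isClosed_closedBall.measurableSet).2
      (((integrableOn_const (isCompact_closedBall _ _).measure_lt_top.ne).add
        hx.integrableOn).const_mul B)
  refine hbound.mono' ((hre.comp_measurable measurable_prodMk_left).mul
    hφ.stronglyMeasurable).aestronglyMeasurable (Filter.Eventually.of_forall fun v => ?_)
  by_cases hv : ‖v‖ ≤ r
  · rw [indicator_of_mem (mem_closedBall_zero_iff.2 hv), norm_mul, mul_comm, Complex.norm_real]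
    refine mul_le_mul (hB v hv) ?_ (norm_nonneg _) hB0
    nlinarith [sq_nonneg (‖f x v‖ - 1)]
  · have h0 : f x v = 0 := by exact_mod_cast hf.eq_zero x v (not_le.1 hv)
    rw [indicator_of_notMem (by simpa using hv), h0, zero_mul, norm_zero]

lemma memLp_source (hf : IsPhaseDensity r fun x v => (f x v : ℂ))
    (hφ : Continuous φ) : MemLp (fun x => ((source φ f x : ℝ) : ℂ)) 2 volume := by
  set Q := Metric.closedBall (0 : R3) r
  have hQ : MeasurableSet Q := Metric.isClosed_closedBall.measurableSet
  set w : R3 → ℂ := Q.indicator fun v => (φ v : ℂ)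
  have hw : MemLp w 2 volume := by
    obtain ⟨B, hB0, hB⟩ := exists_abs_le_of_continuous hφ r
    refine (memLp_indicator_const 2 hQ B
      (Or.inr (isCompact_closedBall _ _).measure_lt_top.ne)).of_le
      ((by fun_prop : Continuous fun v => (φ v : ℂ)).aestronglyMeasurable.indicator hQ)
      (Filter.Eventually.of_forall fun v => ?_)
    by_cases hv : v ∈ Q
    · simp only [w, indicator_of_mem hv, Complex.norm_real, Real.norm_eq_abs]
      exact (hB v (mem_closedBall_zero_iff.1 hv)).trans (le_abs_self B)
    · simp [w, indicator_of_notMem hv]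
  have hmeas : StronglyMeasurable fun x => ((source φ f x : ℝ) : ℂ) := by
    simp only [source_eq_integral]
    have h1 : StronglyMeasurable fun p : R3 × R3 => (φ p.2 : ℂ) :=
      (by fun_prop : Continuous fun p : R3 × R3 => (φ p.2 : ℂ)).stronglyMeasurable
    exact (h1.mul hf.stronglyMeasurable).integral_prod_right'
  refine (memLp_two_iff_integrable_sq_norm hmeas.aestronglyMeasurable).2 ?_
  refine (hf.integrable_norm_sq.integral_prod_left.const_mul (‖toL2 w‖ ^ 2)).mono'
    (hmeas.norm.pow 2).aestronglyMeasurable ?_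
  -- Cauchy-Schwarz in the velocity
  filter_upwards [hf.integrable_norm_sq.prod_right_ae] with x hx
  have hfx : MemLp (fun v => (f x v : ℂ)) 2 volume :=
    (memLp_two_iff_integrable_sq_norm (hf.stronglyMeasurable.comp_measurable
      measurable_prodMk_left).aestronglyMeasurable).2 hx
  have hinner : ((source φ f x : ℝ) : ℂ)
      = inner ℂ (toL2 w) (toL2 fun v => (f x v : ℂ)) := by
    rw [source_eq_integral, L2.inner_def]
    refine integral_congr_ae ?_
    filter_upwards [coeFn_toL2 hw, coeFn_toL2 hfx] with v hv1 hv2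
    rw [hv1, hv2, RCLike.inner_apply]
    by_cases hv : v ∈ Q
    · simp [w, indicator_of_mem hv, mul_comm]
    · have h0 : f x v = 0 := by
        exact_mod_cast hf.eq_zero x v (by simpa [Q] using hv)
      simp [h0]
  rw [Real.norm_of_nonneg (by positivity), hinner, ← norm_toL2_sq hfx, ← mul_pow]
  gcongr
  exact norm_inner_le_norm _ _

/-- The source density, defined point by point in `x`, is also the integral in `v` of the
`L²`-classes of the slices: both have the same pairings with frequency cut-offs. -/
lemma toL2_source_eq_kineticIntegral (hf : IsPhaseDensity r fun x v => (f x v : ℂ))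
    (hφ : Continuous φ) :
    (toL2 fun x => ((source φ f x : ℝ) : ℂ))
      = kineticIntegral (fun v _ => (φ v : ℂ)) fun x v => (f x v : ℂ) := by
  refine eq_of_fourierPairing_eq fun χ hχ hχs => ?_
  have hm := isVelocitySymbol_weight hφ
  rw [fourierPairing_kineticIntegral hm hf hχ hχs,
    fourierPairing_eq_integral_fourier (hχ.integrable_of_hasCompactSupport hχs)
      (hχ.memLp_of_hasCompactSupport hχs)]
  have hprod := integral_prod _ (integrable_fourier_mul hm hf hχ hχs)
  refine Eq.trans (integral_congr_ae ((coeFn_toL2 (memLp_source hf hφ)).mono fun x hx => ?_))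
    hprod.symm
  simp only [hx]
  rw [source_eq_integral, ← integral_const_mul]
  refine integral_congr_ae (Filter.Eventually.of_forall fun v => ?_)
  have h : 𝓕 (fun ξ => (φ v : ℂ) * χ ξ) x = (φ v : ℂ) * 𝓕 χ x := by
    simp only [Real.fourier_eq', ← integral_const_mul, smul_eq_mul]
    congr 1
    ext ξ
    ring
  simp only [h]
  ring

end Source

lemma sourcePhiIntegrand_eq (σ : ℤˣ) {φ : R3 → ℝ} (f : R3 → R3 → ℝ) (v : R3) :
    sourcePhiIntegrand σ φ f v
      = kerConv (fun k => (φ v : ℂ) * phiSymb σ v k) (toL2 fun x => (f x v : ℂ)) := by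
  rw [sourcePhiIntegrand, kerConv_const_mul (B := 2 * (1 + ‖v‖) ^ 2)]
  · have := (contDiff_phiSymb σ).continuous
    fun_prop
  · exact norm_phiSymb_le_of_norm_le' σ le_rfl

section Congr

variable {f f' : R3 → R3 → ℝ}

lemma ae_slice_eq (h : ∀ᵐ p : R3 × R3, f p.1 p.2 = f' p.1 p.2) :
    ∀ᵐ v : R3, ∀ᵐ x : R3, f x v = f' x v := by
  have hswap : ∀ᵐ p : R3 × R3, f p.2 p.1 = f' p.2 p.1 :=
    (Measure.measurePreserving_swap (μ := (volume : Measure R3))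
      (ν := (volume : Measure R3))).quasiMeasurePreserving.ae h
  exact Measure.ae_ae_of_ae_prod hswap

lemma source_congr (φ : R3 → ℝ) (h : ∀ᵐ p : R3 × R3, f p.1 p.2 = f' p.1 p.2) :
    ∀ᵐ x : R3, source φ f x = source φ f' x := by
  have h' : ∀ᵐ x : R3, ∀ᵐ v : R3, f x v = f' x v := Measure.ae_ae_of_ae_prod h
  filter_upwards [h'] with x hx
  exact integral_congr_ae (hx.mono fun v hv => by simp only [hv])

lemma sourcePhiIntegrand_congr (σ : ℤˣ) (φ : R3 → ℝ)
    (h : ∀ᵐ p : R3 × R3, f p.1 p.2 = f' p.1 p.2) :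
    sourcePhiIntegrand σ φ f =ᵐ[volume] sourcePhiIntegrand σ φ f' := by
  filter_upwards [ae_slice_eq h] with v hv
  rw [sourcePhiIntegrand, sourcePhiIntegrand,
    toL2_congr (h' := fun x => (f' x v : ℂ)) (hv.mono fun x hx => by simp only [hx])]

lemma sourceQuadIntegrand_congr (σ : ℤˣ) (φ : R3 → ℝ) (e : R3 → R3)
    (h : ∀ᵐ p : R3 × R3, f p.1 p.2 = f' p.1 p.2) :
    sourceQuadIntegrand σ φ e f =ᵐ[volume] sourceQuadIntegrand σ φ e f' := by
  filter_upwards [ae_slice_eq h] with v hv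
  refine Finset.sum_congr rfl fun j _ => ?_
  rw [toL2_congr (h' := fun x => ((e x j * f' x v : ℝ) : ℂ))
    (hv.mono fun x hx => by simp only [hx])]

end Congr

/-! ### Transported densities -/

/-- A square integrable, Borel measurable density on phase space that vanishes for velocities
larger than `R`. -/
structure IsInitialDensity (R : ℝ) (h₀ : R3 × R3 → ℝ) : Prop where
  stronglyMeasurable : StronglyMeasurable h₀
  memLp : MemLp h₀ 2 volume
  eq_zero : ∀ z, R < ‖z.2‖ → h₀ z = 0

/-- The density `h₀` transported by the flow to time `τ`, times a weight `a(τ, x)`; the weights of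
interest are `1` and the components of the electric field. -/
noncomputable def weightedDensity (bwd : ℝ → R3 × R3 → R3 × R3) (h₀ : R3 × R3 → ℝ)
    (a : ℝ → R3 → ℝ) (τ : ℝ) (x v : R3) : ℂ := ((a τ x * h₀ (bwd τ (x, v)) : ℝ) : ℂ)

section Transport

variable {T : ℝ} {e : ℝ → R3 → R3} {fwd bwd : ℝ → R3 × R3 → R3 × R3} {R : ℝ}
  {h₀ : R3 × R3 → ℝ} {a : ℝ → R3 → ℝ} {A : ℝ} {m : R3 → R3 → ℂ}

/-- The flow from time `0` to time `τ` as a measurable equivalence. -/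
def PhaseFlow.equiv (hΦ : PhaseFlow T e fwd bwd) (τ : ℝ) : R3 × R3 ≃ᵐ R3 × R3 where
  toFun := fwd τ
  invFun := bwd τ
  left_inv := hΦ.bwd_fwd τ
  right_inv := hΦ.fwd_bwd τ
  measurable_toFun := (hΦ.continuous_fwd.comp (by fun_prop : Continuous fun z => (τ, z))).measurable
  measurable_invFun :=
    (hΦ.continuous_bwd.comp (by fun_prop : Continuous fun z => (τ, z))).measurable

lemma PhaseFlow.measurePreserving_equiv (hΦ : PhaseFlow T e fwd bwd) (τ : ℝ) :
    MeasurePreserving (hΦ.equiv τ) := hΦ.measurePreserving_fwd τ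

lemma PhaseFlow.measurePreserving_bwd (hΦ : PhaseFlow T e fwd bwd) (τ : ℝ) :
    MeasurePreserving (bwd τ) := (hΦ.measurePreserving_equiv τ).symm

lemma PhaseFlow.integral_comp_fwd {F : Type*} [NormedAddCommGroup F] [NormedSpace ℝ F]
    (hΦ : PhaseFlow T e fwd bwd) (τ : ℝ) (G : R3 × R3 → F) : ∫ z, G (fwd τ z) = ∫ z, G z :=
  (hΦ.measurePreserving_equiv τ).integral_comp' G

lemma PhaseFlow.integral_comp_bwd {F : Type*} [NormedAddCommGroup F] [NormedSpace ℝ F]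
    (hΦ : PhaseFlow T e fwd bwd) (τ : ℝ) (G : R3 × R3 → F) : ∫ z, G (bwd τ z) = ∫ z, G z :=
  ((hΦ.measurePreserving_equiv τ).symm).integral_comp' G

lemma stronglyMeasurable_weightedDensity (hΦ : PhaseFlow T e fwd bwd)
    (h0 : IsInitialDensity R h₀) (ha : Continuous fun p : ℝ × R3 => a p.1 p.2) :
    StronglyMeasurable fun q : ℝ × (R3 × R3) => weightedDensity bwd h₀ a q.1 q.2.1 q.2.2 := by
  refine Complex.continuous_ofReal.comp_stronglyMeasurable ?_
  have h1 : StronglyMeasurable fun q : ℝ × (R3 × R3) => a q.1 q.2.1 :=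
    (by fun_prop : Continuous fun q : ℝ × (R3 × R3) => a q.1 q.2.1).stronglyMeasurable
  exact h1.mul (h0.stronglyMeasurable.comp_measurable hΦ.continuous_bwd.measurable)

lemma norm_weightedDensity_sq_le (hA : ∀ τ x, |a τ x| ≤ A) (τ : ℝ) (p : R3 × R3) :
    ‖weightedDensity bwd h₀ a τ p.1 p.2‖ ^ 2 ≤ A ^ 2 * ‖h₀ (bwd τ p)‖ ^ 2 := by
  rw [weightedDensity, Complex.norm_real, norm_mul, mul_pow]
  gcongr
  exact hA τ p.1

lemma integrable_norm_bwd_sq (hΦ : PhaseFlow T e fwd bwd) (h0 : IsInitialDensity R h₀) (τ : ℝ) :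
    Integrable fun p => ‖h₀ (bwd τ p)‖ ^ 2 :=
  (hΦ.measurePreserving_bwd τ).integrable_comp_of_integrable (g := fun z => ‖h₀ z‖ ^ 2)
    ((memLp_two_iff_integrable_sq_norm h0.memLp.1).1 h0.memLp)

/-- The force is bounded, so the velocity support of a transported density grows by a bounded
amount: one velocity radius serves all times, initial densities and weights. -/
lemma exists_isPhaseDensity (hΦ : PhaseFlow T e fwd bwd) (R : ℝ) :
    ∃ r, ∀ (h₀ : R3 × R3 → ℝ) (a : ℝ → R3 → ℝ) (A : ℝ), IsInitialDensity R h₀ →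
      (Continuous fun p : ℝ × R3 => a p.1 p.2) → (∀ τ x, |a τ x| ≤ A) →
      ∀ τ, IsPhaseDensity r (weightedDensity bwd h₀ a τ) := by
  obtain ⟨C, hC⟩ := hΦ.exists_norm_le_add
  refine ⟨R + C, fun h₀ a A h0 ha hA τ => ?_⟩
  have hmeas : StronglyMeasurable fun p : R3 × R3 => weightedDensity bwd h₀ a τ p.1 p.2 :=
    (stronglyMeasurable_weightedDensity hΦ h0 ha).comp_measurable measurable_prodMk_left
  refine ⟨hmeas, (memLp_two_iff_integrable_sq_norm hmeas.aestronglyMeasurable).2 ?_,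
    fun x v hv => ?_⟩
  · refine ((integrable_norm_bwd_sq hΦ h0 τ).const_mul (A ^ 2)).mono'
      (hmeas.norm.pow 2).aestronglyMeasurable (Filter.Eventually.of_forall fun p => ?_)
    rw [Real.norm_of_nonneg (by positivity)]
    exact norm_weightedDensity_sq_le hA τ p
  · have := hC τ (x, v)
    rw [weightedDensity, h0.eq_zero _ (by linarith), mul_zero, Complex.ofReal_zero]

lemma integral_norm_weightedDensity_sq_le (hΦ : PhaseFlow T e fwd bwd)
    (h0 : IsInitialDensity R h₀) {r : ℝ} {τ : ℝ}
    (hg : IsPhaseDensity r (weightedDensity bwd h₀ a τ)) (hA : ∀ τ x, |a τ x| ≤ A) :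
    ∫ p : R3 × R3, ‖weightedDensity bwd h₀ a τ p.1 p.2‖ ^ 2 ≤ A ^ 2 * ∫ z, ‖h₀ z‖ ^ 2 := by
  rw [← hΦ.integral_comp_bwd τ fun z => ‖h₀ z‖ ^ 2, ← integral_const_mul]
  exact integral_mono hg.integrable_norm_sq ((integrable_norm_bwd_sq hΦ h0 τ).const_mul _)
    (norm_weightedDensity_sq_le hA τ)

lemma stronglyMeasurable_kineticIntegral (hΦ : PhaseFlow T e fwd bwd)
    (h0 : IsInitialDensity R h₀) (ha : Continuous fun p : ℝ × R3 => a p.1 p.2)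
    (hm : IsVelocitySymbol m) :
    StronglyMeasurable fun τ => kineticIntegral m (weightedDensity bwd h₀ a τ) := by
  have h1 : StronglyMeasurable fun q : (ℝ × R3) × R3 =>
      weightedDensity bwd h₀ a q.1.1 q.2 q.1.2 :=
    StronglyMeasurable.comp_measurable
      (g := fun q : (ℝ × R3) × R3 => (q.1.1, (q.2, q.1.2)))
      (stronglyMeasurable_weightedDensity hΦ h0 ha) (by fun_prop)
  have h2 : StronglyMeasurable fun q : ℝ × R3 =>
      toL2 fun x => weightedDensity bwd h₀ a q.1 x q.2 :=
    stronglyMeasurable_toL2 (g := fun (q : ℝ × R3) x => weightedDensity bwd h₀ a q.1 x q.2) h1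
  have h3 : StronglyMeasurable fun q : ℝ × R3 =>
      kerConv (m q.2) (toL2 fun x => weightedDensity bwd h₀ a q.1 x q.2) :=
    Continuous.comp_stronglyMeasurable (g := fun p : R3 × L2x => kerConv (m p.1) p.2)
      (f := fun q : ℝ × R3 => (q.2, toL2 fun x => weightedDensity bwd h₀ a q.1 x q.2))
      hm.continuous_kerConv (measurable_snd.stronglyMeasurable.prodMk h2)
  simp only [kineticIntegral]
  exact h3.integral_prod_right'

lemma exists_norm_kineticIntegral_le (hΦ : PhaseFlow T e fwd bwd)
    (h0 : IsInitialDensity R h₀) (ha : Continuous fun p : ℝ × R3 => a p.1 p.2)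
    (hA : ∀ τ x, |a τ x| ≤ A) (hm : IsVelocitySymbol m) :
    ∃ B, ∀ τ, ‖kineticIntegral m (weightedDensity bwd h₀ a τ)‖ ≤ B := by
  obtain ⟨r, hr⟩ := exists_isPhaseDensity hΦ R
  obtain ⟨B, hB⟩ := hm.exists_bound r
  refine ⟨max B 0 * (volume.real (Metric.closedBall (0 : R3) r) + A ^ 2 * ∫ z, ‖h₀ z‖ ^ 2),
    fun τ => ?_⟩
  have hg := hr h₀ a A h0 ha hA τ
  refine (norm_kineticIntegral_le hm hg (le_max_right B 0)
    fun v hv k => (hB v hv k).trans (le_max_left _ _)).trans ?_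
  gcongr
  exact integral_norm_weightedDensity_sq_le hΦ h0 hg hA

lemma continuous_kerConv_GSymb (σ : ℤˣ) (t : ℝ) :
    Continuous fun p : ℝ × L2x => kerConv (GSymb σ (t - p.1)) p.2 := by
  have := continuous_GSymb σ
  exact continuous_kerConv (m := fun τ => GSymb σ (t - τ)) (by fun_prop)
    fun a => ⟨1, Filter.Eventually.of_forall fun b k => norm_GSymb_le σ _ k⟩

lemma continuous_GSymb_slice (σ : ℤˣ) (t : ℝ) : Continuous (GSymb σ t) := by
  have := continuous_GSymb σ
  fun_prop

lemma intervalIntegrable_kerConv_GSymb (hΦ : PhaseFlow T e fwd bwd)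
    (h0 : IsInitialDensity R h₀) (ha : Continuous fun p : ℝ × R3 => a p.1 p.2)
    (hA : ∀ τ x, |a τ x| ≤ A) (hm : IsVelocitySymbol m) (σ : ℤˣ) (t : ℝ) :
    IntervalIntegrable (fun τ => kerConv (GSymb σ (t - τ))
      (kineticIntegral m (weightedDensity bwd h₀ a τ))) volume 0 t := by
  obtain ⟨B, hB⟩ := exists_norm_kineticIntegral_le hΦ h0 ha hA hm
  have hmeas : StronglyMeasurable fun τ => kerConv (GSymb σ (t - τ))
      (kineticIntegral m (weightedDensity bwd h₀ a τ)) :=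
    Continuous.comp_stronglyMeasurable
      (g := fun p : ℝ × L2x => kerConv (GSymb σ (t - p.1)) p.2)
      (f := fun τ => (τ, kineticIntegral m (weightedDensity bwd h₀ a τ)))
      (continuous_kerConv_GSymb σ t)
      (stronglyMeasurable_id.prodMk (stronglyMeasurable_kineticIntegral hΦ h0 ha hm))
  refine (intervalIntegrable_const (c := B)).mono_fun' hmeas.aestronglyMeasurable
    (Filter.Eventually.of_forall fun τ => ?_)
  refine (norm_kerConv_le (continuous_GSymb_slice σ _) (norm_GSymb_le σ _) _).trans ?_
  rw [one_mul]
  exact hB τ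

/-! ### Duhamel integrals along the characteristics -/

/-- The frequency cut-off `χ` times the symbol of `G^osc_±(t - τ)`. -/
noncomputable def propagatedCutoff (σ : ℤˣ) (t : ℝ) (χ : R3 → ℂ) (τ : ℝ) (ξ : R3) : ℂ :=
  GSymb σ (t - τ) ((2 * Real.pi) • ξ) * χ ξ

/-- The test function on phase space dual to the velocity integral with symbol `m`, followed by
convolution with `G^osc_±(t - τ)`: the Fourier integral of
`m(v, 2πξ) e^{λ_±(2πξ)(t - τ)} a_±(2πξ) χ(ξ)`. -/
noncomputable def testField (σ : ℤˣ) (t : ℝ) (χ : R3 → ℂ) (m : R3 → R3 → ℂ) (τ : ℝ)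
    (z : R3 × R3) : ℂ :=
  𝓕 (fun ξ => m z.2 ((2 * Real.pi) • ξ) * propagatedCutoff σ t χ τ ξ) z.1

/-- The integrand of `testField`. -/
noncomputable def testIntegrand (σ : ℤˣ) (t : ℝ) (χ : R3 → ℂ) (m : R3 → R3 → ℂ) (τ : ℝ)
    (z : R3 × R3) (ξ : R3) : ℂ :=
  Complex.exp (((-2 * Real.pi * inner ℝ ξ z.1 : ℝ) : ℂ) * Complex.I) *
    (m z.2 ((2 * Real.pi) • ξ) * (GSymb σ (t - τ) ((2 * Real.pi) • ξ) * χ ξ))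

variable {χ : R3 → ℂ}

lemma testField_eq_integral (σ : ℤˣ) (t : ℝ) (χ : R3 → ℂ) (m : R3 → R3 → ℂ) (τ : ℝ)
    (z : R3 × R3) : testField σ t χ m τ z = ∫ ξ, testIntegrand σ t χ m τ z ξ := by
  simp only [testField, Real.fourier_eq', smul_eq_mul, testIntegrand, propagatedCutoff]

lemma continuous_testIntegrand (σ : ℤˣ) (t : ℝ) (hχ : Continuous χ) (hm : IsVelocitySymbol m) :
    Continuous fun p : (ℝ × (R3 × R3)) × R3 => testIntegrand σ t χ m p.1.1 p.1.2 p.2 := by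
  have h1 := continuous_GSymb σ
  have h2 := hm.continuous
  unfold testIntegrand
  fun_prop

lemma testIntegrand_eq_zero (σ : ℤˣ) (t : ℝ) (τ : ℝ) (z : R3 × R3) {ξ : R3}
    (hξ : ξ ∉ tsupport χ) : testIntegrand σ t χ m τ z ξ = 0 := by
  simp [testIntegrand, image_eq_zero_of_notMem_tsupport hξ]

lemma testField_eq_setIntegral (σ : ℤˣ) (t : ℝ) (χ : R3 → ℂ) (m : R3 → R3 → ℂ) (τ : ℝ)
    (z : R3 × R3) :
    testField σ t χ m τ z = ∫ ξ in tsupport χ, testIntegrand σ t χ m τ z ξ := by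
  rw [testField_eq_integral, setIntegral_eq_integral_of_forall_compl_eq_zero]
  exact fun ξ hξ => testIntegrand_eq_zero σ t τ z hξ

lemma continuous_testField (σ : ℤˣ) (t : ℝ) (hχ : Continuous χ) (hχs : HasCompactSupport χ)
    (hm : IsVelocitySymbol m) :
    Continuous fun p : ℝ × (R3 × R3) => testField σ t χ m p.1 p.2 := by
  simp only [testField_eq_setIntegral]
  exact continuous_parametric_integral_of_continuous
    (f := fun (p : ℝ × (R3 × R3)) ξ => testIntegrand σ t χ m p.1 p.2 ξ)
    (continuous_testIntegrand σ t hχ hm) hχs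

lemma continuous_propagatedCutoff (σ : ℤˣ) (t τ : ℝ) (hχ : Continuous χ) :
    Continuous (propagatedCutoff σ t χ τ) := by
  have := continuous_GSymb σ
  unfold propagatedCutoff
  fun_prop

lemma hasCompactSupport_propagatedCutoff (σ : ℤˣ) (t τ : ℝ) (hχs : HasCompactSupport χ) :
    HasCompactSupport (propagatedCutoff σ t χ τ) := hχs.mul_left

lemma fourierPairing_kerConv_GSymb (σ : ℤˣ) (t τ : ℝ) (hχ : Continuous χ)
    (hχs : HasCompactSupport χ) (u : L2x) :
    fourierPairing χ (kerConv (GSymb σ (t - τ)) u)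
      = fourierPairing (propagatedCutoff σ t χ τ) u :=
  fourierPairing_kerConv (continuous_GSymb_slice σ _) (norm_GSymb_le σ _)
    (hχ.memLp_of_hasCompactSupport hχs) u

lemma fourierPairing_kerConv_kineticIntegral {r : ℝ} {g : R3 → R3 → ℂ} (hg : IsPhaseDensity r g)
    (hm : IsVelocitySymbol m) (σ : ℤˣ) (t τ : ℝ) (hχ : Continuous χ)
    (hχs : HasCompactSupport χ) :
    fourierPairing χ (kerConv (GSymb σ (t - τ)) (kineticIntegral m g))
      = ∫ z : R3 × R3, testField σ t χ m τ z * g z.1 z.2 := by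
  rw [fourierPairing_kerConv_GSymb σ t τ hχ hχs, fourierPairing_kineticIntegral hm hg
    (continuous_propagatedCutoff σ t τ hχ) (hasCompactSupport_propagatedCutoff σ t τ hχs)]
  rfl

/-- The change of variables along the flow that turns a pairing at time `τ` into an integral over
the initial positions and velocities. -/
lemma fourierPairing_kerConv_eq_integral_fwd (hΦ : PhaseFlow T e fwd bwd)
    (h0 : IsInitialDensity R h₀) (ha : Continuous fun p : ℝ × R3 => a p.1 p.2)
    (hA : ∀ τ x, |a τ x| ≤ A) (hm : IsVelocitySymbol m) (σ : ℤˣ) (t τ : ℝ)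
    (hχ : Continuous χ) (hχs : HasCompactSupport χ) :
    fourierPairing χ (kerConv (GSymb σ (t - τ))
      (kineticIntegral m (weightedDensity bwd h₀ a τ))) = ∫ z : R3 × R3,
        testField σ t χ m τ (fwd τ z) * (a τ (fwd τ z).1 : ℂ) * (h₀ z : ℂ) := by
  obtain ⟨r, hr⟩ := exists_isPhaseDensity hΦ R
  rw [fourierPairing_kerConv_kineticIntegral (hr h₀ a A h0 ha hA τ) hm σ t τ hχ hχs,
    ← hΦ.integral_comp_fwd τ]
  simp only [weightedDensity, Prod.mk.eta, hΦ.bwd_fwd, Complex.ofReal_mul, mul_assoc]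

lemma integrable_testField_fwd (hΦ : PhaseFlow T e fwd bwd)
    (h0 : IsInitialDensity R h₀) (ha : Continuous fun p : ℝ × R3 => a p.1 p.2)
    (hA : ∀ τ x, |a τ x| ≤ A) (hm : IsVelocitySymbol m) (σ : ℤˣ) (t τ : ℝ)
    (hχ : Continuous χ) (hχs : HasCompactSupport χ) :
    Integrable fun z : R3 × R3 =>
      testField σ t χ m τ (fwd τ z) * (a τ (fwd τ z).1 : ℂ) * (h₀ z : ℂ) := by
  obtain ⟨r, hr⟩ := exists_isPhaseDensity hΦ R
  have h1 := integrable_fourier_mul hm (hr h₀ a A h0 ha hA τ)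
    (continuous_propagatedCutoff σ t τ hχ) (hasCompactSupport_propagatedCutoff σ t τ hχs)
  have h2 := (hΦ.measurePreserving_fwd τ).integrable_comp_of_integrable h1
  refine h2.congr (Filter.Eventually.of_forall fun z => ?_)
  simp only [Function.comp_apply, weightedDensity, Prod.mk.eta, hΦ.bwd_fwd, Complex.ofReal_mul,
    mul_assoc, testField]

lemma integrable_testField_fwd_prod (hΦ : PhaseFlow T e fwd bwd)
    (h0 : IsInitialDensity R h₀) (ha : Continuous fun p : ℝ × R3 => a p.1 p.2)
    (hA : ∀ τ x, |a τ x| ≤ A) (hm : IsVelocitySymbol m) (σ : ℤˣ) (t : ℝ)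
    (hχ : Continuous χ) (hχs : HasCompactSupport χ) :
    Integrable (fun p : ℝ × (R3 × R3) => testField σ t χ m p.1 (fwd p.1 p.2)
      * (a p.1 (fwd p.1 p.2).1 : ℂ) * (h₀ p.2 : ℂ))
      ((volume.restrict (Ioc 0 t)).prod volume) := by
  obtain ⟨r, hr⟩ := exists_isPhaseDensity hΦ R
  obtain ⟨B, hB⟩ := hm.exists_bound r
  have hfwd := hΦ.continuous_fwd
  have hfield := continuous_testField σ t hχ hχs hm
  have hmeas : StronglyMeasurable (fun p : ℝ × (R3 × R3) => testField σ t χ m p.1 (fwd p.1 p.2)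
      * (a p.1 (fwd p.1 p.2).1 : ℂ) * (h₀ p.2 : ℂ)) := by
    have hc : Continuous fun p : ℝ × (R3 × R3) => testField σ t χ m p.1 (fwd p.1 p.2)
        * (a p.1 (fwd p.1 p.2).1 : ℂ) := by fun_prop
    exact hc.stronglyMeasurable.mul (Complex.continuous_ofReal.comp_stronglyMeasurable
      (h0.stronglyMeasurable.comp_measurable measurable_snd))
  refine (integrable_prod_iff hmeas.aestronglyMeasurable).2 ⟨Filter.Eventually.of_forall fun τ =>
    integrable_testField_fwd hΦ h0 ha hA hm σ t τ hχ hχs, ?_⟩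
  refine Integrable.of_bound (C := volume.real (Metric.closedBall (0 : R3) r)
      * (B ^ 2 * ∫ ξ, ‖χ ξ‖ ^ 2) + A ^ 2 * ∫ z, ‖h₀ z‖ ^ 2)
    hmeas.norm.integral_prod_right'.aestronglyMeasurable (Filter.Eventually.of_forall fun τ => ?_)
  rw [Real.norm_of_nonneg (integral_nonneg fun _ => norm_nonneg _)]
  have hg := hr h₀ a A h0 ha hA τ
  have h1 := integral_norm_fourier_mul_le hm hg hB
    (continuous_propagatedCutoff σ t τ hχ) (hasCompactSupport_propagatedCutoff σ t τ hχs)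
  rw [← hΦ.integral_comp_fwd τ] at h1
  have h2 : ∫ ξ, ‖propagatedCutoff σ t χ τ ξ‖ ^ 2 ≤ 1 ^ 2 * ∫ ξ, ‖χ ξ‖ ^ 2 :=
    integral_norm_symbol_mul_sq_le (continuous_GSymb_slice σ (t - τ)) (norm_GSymb_le σ _) hχ hχs
  rw [one_pow, one_mul] at h2
  calc ∫ z, ‖testField σ t χ m τ (fwd τ z) * (a τ (fwd τ z).1 : ℂ) * (h₀ z : ℂ)‖
      ≤ volume.real (Metric.closedBall (0 : R3) r)
          * (B ^ 2 * ∫ ξ, ‖propagatedCutoff σ t χ τ ξ‖ ^ 2)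
        + ∫ p : R3 × R3, ‖weightedDensity bwd h₀ a τ p.1 p.2‖ ^ 2 := by
        refine le_trans (le_of_eq ?_) h1
        simp only [weightedDensity, Prod.mk.eta, hΦ.bwd_fwd, Complex.ofReal_mul, mul_assoc,
          testField]
    _ ≤ _ := by
        gcongr
        exact integral_norm_weightedDensity_sq_le hΦ h0 hg hA

/-- Tested against a frequency cut-off, a Duhamel integral becomes an integral over the initial
positions and velocities of time integrals along the characteristics. -/
lemma fourierPairing_duhamel (hΦ : PhaseFlow T e fwd bwd)
    (h0 : IsInitialDensity R h₀) (ha : Continuous fun p : ℝ × R3 => a p.1 p.2)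
    (hA : ∀ τ x, |a τ x| ≤ A) (hm : IsVelocitySymbol m) (σ : ℤˣ) {t : ℝ} (ht : 0 ≤ t)
    (hχ : Continuous χ) (hχs : HasCompactSupport χ) :
    fourierPairing χ (spacetimeConv σ
      (fun τ => kineticIntegral m (weightedDensity bwd h₀ a τ)) t) = ∫ z : R3 × R3,
        (∫ τ in (0 : ℝ)..t, testField σ t χ m τ (fwd τ z) * (a τ (fwd τ z).1 : ℂ))
          * (h₀ z : ℂ) := by
  rw [spacetimeConv, ← ContinuousLinearMap.intervalIntegral_comp_comm _
    (intervalIntegrable_kerConv_GSymb hΦ h0 ha hA hm σ t)]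
  simp only [fourierPairing_kerConv_eq_integral_fwd hΦ h0 ha hA hm σ t _ hχ hχs]
  rw [intervalIntegral.integral_of_le ht,
    integral_integral_swap (integrable_testField_fwd_prod hΦ h0 ha hA hm σ t hχ hχs)]
  simp only [intervalIntegral.integral_of_le ht, integral_mul_const]

lemma integrable_intervalIntegral_testField (hΦ : PhaseFlow T e fwd bwd)
    (h0 : IsInitialDensity R h₀) (ha : Continuous fun p : ℝ × R3 => a p.1 p.2)
    (hA : ∀ τ x, |a τ x| ≤ A) (hm : IsVelocitySymbol m) (σ : ℤˣ) {t : ℝ} (ht : 0 ≤ t)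
    (hχ : Continuous χ) (hχs : HasCompactSupport χ) :
    Integrable fun z : R3 × R3 =>
      (∫ τ in (0 : ℝ)..t, testField σ t χ m τ (fwd τ z) * (a τ (fwd τ z).1 : ℂ))
          * (h₀ z : ℂ) := by
  have h := (integrable_testField_fwd_prod hΦ h0 ha hA hm σ t hχ hχs).integral_prod_right
  simpa only [intervalIntegral.integral_of_le ht, integral_mul_const] using h

end Transport

section Characteristics

variable {T : ℝ} {e : ℝ → R3 → R3} {fwd bwd : ℝ → R3 × R3 → R3 × R3} {R : ℝ}
  {h₀ : R3 × R3 → ℝ} {φ : R3 → ℝ} {χ : R3 → ℂ}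

lemma fderiv_phiSymb_mul_apply (σ : ℤˣ) (φ : R3 → ℝ) (v k w : R3) :
    fderiv ℝ (fun u : R3 => phiSymb σ u k * ((φ u : ℝ) : ℂ)) v w
      = ∑ j, gradPhiSymb σ φ j v k * (w j : ℂ) := by
  conv_lhs => rw [← (EuclideanSpace.basisFun (Fin 3) ℝ).sum_repr w]
  rw [map_sum]
  refine Finset.sum_congr rfl fun j _ => ?_
  simp [gradPhiSymb, mul_comm]

/-- The integrand of the dual test function, followed along a characteristic. The phase
`λ_± + i k · v̂`, which the time derivative of the exponentials brings down, cancels the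
denominator of `φ_{±,1}`; the field enters through the velocity derivative of the symbol. -/
lemma hasDerivAt_testIntegrand (hΦ : PhaseFlow T e fwd bwd) (hφ : ContDiff ℝ 1 φ) (σ : ℤˣ)
    (t : ℝ) (z : R3 × R3) (ξ : R3) {τ : ℝ} (hτ : τ ∈ Ioo 0 T) :
    HasDerivAt (fun s => testIntegrand σ t χ (fun v k => (φ v : ℂ) * phiSymb σ v k) s (fwd s z) ξ)
      (-testIntegrand σ t χ (fun v _ => (φ v : ℂ)) τ (fwd τ z) ξ
        + ∑ j, testIntegrand σ t χ (gradPhiSymb σ φ j) τ (fwd τ z) ξ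
          * ((e τ (fwd τ z).1 j : ℝ) : ℂ)) τ := by
  set k : R3 := (2 * Real.pi) • ξ with hk
  set v : R3 := (fwd τ z).2
  set p : ℝ := inner ℝ k (hatv v) with hp
  set x : R3 := (fwd τ z).1
  set L : ℂ := Complex.exp (((-2 * Real.pi * inner ℝ ξ x : ℝ) : ℂ) * Complex.I)
  have hX := hΦ.hasDerivAt_fst z τ hτ
  have hV := hΦ.hasDerivAt_snd z τ hτ
  have h1 : HasDerivAt (fun s => Complex.exp
      (((-2 * Real.pi * inner ℝ ξ (fwd s z).1 : ℝ) : ℂ) * Complex.I))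
      (-(Complex.I * (p : ℂ)) * L) τ := by
    have hin : HasDerivAt (fun s => inner ℝ ξ (fwd s z).1) (inner ℝ ξ (hatv v)) τ := by
      simpa using (hasDerivAt_const τ ξ).inner ℝ hX
    have := (((hin.const_mul (-2 * Real.pi)).ofReal_comp).mul_const Complex.I).cexp
    refine this.congr_deriv ?_
    rw [hp, hk, inner_smul_left]
    simp only [L, x]
    push_cast
    simp only [conj_trivial]
    push_cast
    ring
  have h2 : HasDerivAt (fun s => phiSymb σ (fwd s z).2 k * ((φ (fwd s z).2 : ℝ) : ℂ))
      (∑ j, gradPhiSymb σ φ j v k * ((e τ x j : ℝ) : ℂ)) τ := by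
    rw [← fderiv_phiSymb_mul_apply]
    have hd : DifferentiableAt ℝ (fun u : R3 => phiSymb σ u k * ((φ u : ℝ) : ℂ)) v :=
      ((contDiff_phiSymb_mul_weight σ hφ).comp (f := fun u : R3 => (u, k))
        (contDiff_id.prodMk contDiff_const)).differentiable one_ne_zero v
    exact hd.hasFDerivAt.comp_hasDerivAt τ hV
  have h3 := hasDerivAt_GSymb σ t τ k
  have h4 := (h1.mul (h2.mul (h3.mul_const (χ ξ))))
  refine (h4.congr_of_eventuallyEq (Filter.Eventually.of_forall fun s => ?_)).congr_deriv ?_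
  · simp only [testIntegrand, Pi.mul_apply]
    ring
  · have hphase : phiSymb σ v k * (lam σ k + Complex.I * (p : ℂ)) = 1 :=
      inv_mul_cancel₀ (phase_ne_zero σ v k)
    have hsum : ∑ j, testIntegrand σ t χ (gradPhiSymb σ φ j) τ (fwd τ z) ξ
          * ((e τ (fwd τ z).1 j : ℝ) : ℂ)
        = L * ((∑ j, gradPhiSymb σ φ j v k * ((e τ x j : ℝ) : ℂ))
          * (GSymb σ (t - τ) k * χ ξ)) := by
      rw [Finset.sum_mul, Finset.mul_sum]
      refine Finset.sum_congr rfl fun j _ => ?_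
      simp only [testIntegrand, L, x, v, k]
      ring
    rw [hsum]
    simp only [testIntegrand]
    change -(Complex.I * (p : ℂ)) * L *
          (phiSymb σ v k * (φ v : ℂ) * (GSymb σ (t - τ) k * χ ξ))
        + L * ((∑ j, gradPhiSymb σ φ j v k * ((e τ x j : ℝ) : ℂ)) * (GSymb σ (t - τ) k * χ ξ)
          + phiSymb σ v k * (φ v : ℂ) * (-(lam σ k * GSymb σ (t - τ) k) * χ ξ))
      = -(L * ((φ v : ℂ) * (GSymb σ (t - τ) k * χ ξ))) + _
    linear_combination (-(L * (φ v : ℂ) * GSymb σ (t - τ) k * χ ξ)) * hphase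

/-- The change of the dual test function along a characteristic. -/
lemma testField_sub_testField (hΦ : PhaseFlow T e fwd bwd) (hφ : ContDiff ℝ 1 φ) (σ : ℤˣ)
    {t : ℝ} (ht : t ∈ Icc 0 T) (z : R3 × R3) (hχ : Continuous χ) (hχs : HasCompactSupport χ) :
    testField σ t χ (fun v k => (φ v : ℂ) * phiSymb σ v k) t (fwd t z)
        - testField σ t χ (fun v k => (φ v : ℂ) * phiSymb σ v k) 0 (fwd 0 z)
      = -(∫ τ in (0 : ℝ)..t, testField σ t χ (fun v _ => (φ v : ℂ)) τ (fwd τ z))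
        + ∑ j, ∫ τ in (0 : ℝ)..t, testField σ t χ (gradPhiSymb σ φ j) τ (fwd τ z)
          * ((e τ (fwd τ z).1 j : ℝ) : ℂ) := by
  have hm := isVelocitySymbol_phiSymb_mul σ hφ.continuous
  have hw := isVelocitySymbol_weight hφ.continuous
  have hd := isVelocitySymbol_gradPhiSymb σ hφ
  have hfwd : Continuous fun τ => fwd τ z :=
    hΦ.continuous_fwd.comp (by fun_prop : Continuous fun τ : ℝ => (τ, z))
  have hfield := hΦ.continuous_field
  have hcomp : ∀ {m : R3 → R3 → ℂ}, IsVelocitySymbol m →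
      Continuous fun q : ℝ × R3 => testIntegrand σ t χ m q.1 (fwd q.1 z) q.2 := fun hm =>
    (continuous_testIntegrand σ t hχ hm).comp
      (f := fun q : ℝ × R3 => ((q.1, fwd q.1 z), q.2)) (by fun_prop)
  have hcompF : ∀ {m : R3 → R3 → ℂ}, IsVelocitySymbol m →
      Continuous fun τ : ℝ => testField σ t χ m τ (fwd τ z) := fun hm =>
    (continuous_testField σ t hχ hχs hm).comp (f := fun τ : ℝ => (τ, fwd τ z)) (by fun_prop)
  have hej : ∀ j, Continuous fun τ => ((e τ (fwd τ z).1 j : ℝ) : ℂ) := fun j => by fun_prop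
  -- the derivative along the characteristic
  set D : ℝ → R3 → ℂ := fun τ ξ => -testIntegrand σ t χ (fun v _ => (φ v : ℂ)) τ (fwd τ z) ξ
    + ∑ j, testIntegrand σ t χ (gradPhiSymb σ φ j) τ (fwd τ z) ξ
      * ((e τ (fwd τ z).1 j : ℝ) : ℂ) with hD
  have hDc : Continuous fun q : ℝ × R3 => D q.1 q.2 := by
    refine (hcomp hw).neg.add (continuous_finsetSum _ fun j _ => (hcomp (hd j)).mul ?_)
    exact (hej j).comp continuous_fst
  have hFTC : ∀ ξ, testIntegrand σ t χ (fun v k => (φ v : ℂ) * phiSymb σ v k) t (fwd t z) ξ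
      - testIntegrand σ t χ (fun v k => (φ v : ℂ) * phiSymb σ v k) 0 (fwd 0 z) ξ
        = ∫ τ in (0 : ℝ)..t, D τ ξ := fun ξ => by
    refine (intervalIntegral.integral_eq_sub_of_hasDerivAt_of_le ht.1
      (f := fun s => testIntegrand σ t χ (fun v k => (φ v : ℂ) * phiSymb σ v k) s (fwd s z) ξ)
      ?_ (fun τ hτ => hasDerivAt_testIntegrand hΦ hφ σ t z ξ ⟨hτ.1, hτ.2.trans_le ht.2⟩)
      ?_).symm
    · exact ((hcomp hm).comp (f := fun τ : ℝ => (τ, ξ)) (by fun_prop)).continuousOn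
    · exact (hDc.comp (f := fun τ : ℝ => (τ, ξ)) (by fun_prop)).intervalIntegrable 0 t
  have hint : ∀ {m : R3 → R3 → ℂ}, IsVelocitySymbol m → ∀ τ,
      Integrable (fun ξ => testIntegrand σ t χ m τ (fwd τ z) ξ)
        (volume.restrict (tsupport χ)) := fun hm τ =>
    (((hcomp hm).comp (f := fun ξ : R3 => (τ, ξ)) (by fun_prop)).continuousOn.integrableOn_compact
      hχs)
  rw [testField_eq_setIntegral, testField_eq_setIntegral, ← integral_sub (hint hm t) (hint hm 0)]
  simp only [hFTC]
  have hswap : ∫ ξ in tsupport χ, ∫ τ in (0 : ℝ)..t, D τ ξ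
      = ∫ τ in (0 : ℝ)..t, ∫ ξ in tsupport χ, D τ ξ := by
    refine (intervalIntegral_integral_swap ?_).symm
    rw [Measure.prod_restrict]
    exact (hDc.continuousOn.integrableOn_compact ((isCompact_uIcc (a := 0) (b := t)).prod
      hχs)).mono_set (prod_mono_left uIoc_subset_uIcc)
  rw [hswap]
  have hinner : ∀ τ, ∫ ξ in tsupport χ, D τ ξ
      = -testField σ t χ (fun v _ => (φ v : ℂ)) τ (fwd τ z)
        + ∑ j, testField σ t χ (gradPhiSymb σ φ j) τ (fwd τ z)
          * ((e τ (fwd τ z).1 j : ℝ) : ℂ) := fun τ => by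
    simp only [hD, testField_eq_setIntegral]
    have i1 : Integrable (fun ξ => -testIntegrand σ t χ (fun v _ => (φ v : ℂ)) τ (fwd τ z) ξ)
      (volume.restrict (tsupport χ)) := (hint hw τ).neg
    have i2 : ∀ j, Integrable (fun ξ => testIntegrand σ t χ (gradPhiSymb σ φ j) τ (fwd τ z) ξ
        * ((e τ (fwd τ z).1 j : ℝ) : ℂ)) (volume.restrict (tsupport χ)) := fun j =>
      (hint (hd j) τ).mul_const _
    rw [integral_add i1 (integrable_finsetSum _ fun j _ => i2 j), integral_neg,
      integral_finsetSum _ fun j _ => i2 j]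
    simp only [integral_mul_const]
  simp only [hinner]
  have c1 : Continuous fun τ => -testField σ t χ (fun v _ => (φ v : ℂ)) τ (fwd τ z) :=
    (hcompF hw).neg
  have c2 : ∀ j, Continuous fun τ => testField σ t χ (gradPhiSymb σ φ j) τ (fwd τ z)
      * ((e τ (fwd τ z).1 j : ℝ) : ℂ) := fun j => (hcompF (hd j)).mul (hej j)
  rw [intervalIntegral.integral_add (c1.intervalIntegrable 0 t)
    ((continuous_finsetSum _ fun j _ => c2 j).intervalIntegrable 0 t),
    intervalIntegral.integral_neg,
    intervalIntegral.integral_finsetSum fun j _ => (c2 j).intervalIntegrable 0 t]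

end Characteristics

/-! ### The decomposition for Borel measurable densities -/

section Decomposition

variable {T : ℝ} {e : ℝ → R3 → R3} {fwd bwd : ℝ → R3 × R3 → R3 × R3} {R : ℝ}
  {h₀ : R3 × R3 → ℝ} {φ : R3 → ℝ}

/-- The transported density as a function of position and velocity. -/
def transportedDensity (bwd : ℝ → R3 × R3 → R3 × R3) (h₀ : R3 × R3 → ℝ) (τ : ℝ) (x v : R3) : ℝ :=
  h₀ (bwd τ (x, v))

lemma weightedDensity_one (bwd : ℝ → R3 × R3 → R3 × R3) (h₀ : R3 × R3 → ℝ) (τ : ℝ) :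
    weightedDensity bwd h₀ (fun _ _ => 1) τ
      = fun x v => ((transportedDensity bwd h₀ τ x v : ℝ) : ℂ) := by
  ext x v
  simp [weightedDensity, transportedDensity]

lemma exists_isPhaseDensity_transported (hΦ : PhaseFlow T e fwd bwd)
    (h0 : IsInitialDensity R h₀) :
    ∃ r, ∀ τ, IsPhaseDensity r (fun x v => ((transportedDensity bwd h₀ τ x v : ℝ) : ℂ)) ∧
      ∀ j, IsPhaseDensity r (weightedDensity bwd h₀ (fun τ x => e τ x j) τ) := by
  obtain ⟨r, hr⟩ := exists_isPhaseDensity hΦ R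
  obtain ⟨C, hC⟩ := hΦ.exists_norm_field_le
  have hfield := hΦ.continuous_field
  refine ⟨r, fun τ => ⟨?_, fun j => hr h₀ _ C h0 (by fun_prop) (fun τ x =>
    (PiLp.norm_apply_le (e τ x) j).trans (hC τ x)) τ⟩⟩
  rw [← weightedDensity_one]
  exact hr h₀ _ 1 h0 continuous_const (fun _ _ => by simp) τ

lemma sourcePhi_eq_kineticIntegral (σ : ℤˣ) (φ : R3 → ℝ) (f : R3 → R3 → ℝ) :
    sourcePhi σ φ f = kineticIntegral (fun v k => (φ v : ℂ) * phiSymb σ v k)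
      fun x v => (f x v : ℂ) := by
  simp only [sourcePhi, kineticIntegral, sourcePhiIntegrand_eq]

lemma sourceQuad_eq_sum (hΦ : PhaseFlow T e fwd bwd) (h0 : IsInitialDensity R h₀)
    (hφ : ContDiff ℝ 1 φ) (σ : ℤˣ) (τ : ℝ) :
    Integrable (sourceQuadIntegrand σ φ (e τ) (transportedDensity bwd h₀ τ)) ∧
    sourceQuad σ φ (e τ) (transportedDensity bwd h₀ τ)
      = ∑ j, kineticIntegral (gradPhiSymb σ φ j)
          (weightedDensity bwd h₀ (fun τ x => e τ x j) τ) := by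
  obtain ⟨r, hr⟩ := exists_isPhaseDensity_transported hΦ h0
  have hint := fun j => integrable_kerConv_toL2 (isVelocitySymbol_gradPhiSymb σ hφ j)
    ((hr τ).2 j)
  exact ⟨integrable_finsetSum _ fun j _ => hint j, integral_finsetSum _ fun j _ => hint j⟩

lemma spacetimeConv_sourceQuad_eq_sum (hΦ : PhaseFlow T e fwd bwd) (h0 : IsInitialDensity R h₀)
    (hφ : ContDiff ℝ 1 φ) (σ : ℤˣ) (t : ℝ) :
    IntervalIntegrable (fun τ => kerConv (GSymb σ (t - τ))
      (sourceQuad σ φ (e τ) (transportedDensity bwd h₀ τ))) volume 0 t ∧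
    spacetimeConv σ (fun τ => sourceQuad σ φ (e τ) (transportedDensity bwd h₀ τ)) t
      = ∑ j, spacetimeConv σ (fun τ => kineticIntegral (gradPhiSymb σ φ j)
          (weightedDensity bwd h₀ (fun τ x => e τ x j) τ)) t := by
  obtain ⟨C, hC⟩ := hΦ.exists_norm_field_le
  have hfield := hΦ.continuous_field
  have hint := fun j : Fin 3 => intervalIntegrable_kerConv_GSymb hΦ h0 (a := fun τ x => e τ x j)
    (by fun_prop) (fun τ x => (PiLp.norm_apply_le (e τ x) j).trans (hC τ x))
    (isVelocitySymbol_gradPhiSymb σ hφ j) σ t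
  simp only [spacetimeConv, (sourceQuad_eq_sum hΦ h0 hφ σ _).2,
    kerConv_sum _ (continuous_GSymb_slice σ _) (norm_GSymb_le σ _)]
  refine ⟨?_, intervalIntegral.integral_finsetSum fun j _ => hint j⟩
  have := IntervalIntegrable.sum Finset.univ fun j _ => hint j
  rwa [Finset.sum_fn] at this

lemma toL2_source_transported (hΦ : PhaseFlow T e fwd bwd) (h0 : IsInitialDensity R h₀)
    (hφ : Continuous φ) (τ : ℝ) :
    (toL2 fun x => ((source φ (transportedDensity bwd h₀ τ) x : ℝ) : ℂ))
      = kineticIntegral (fun v _ => (φ v : ℂ)) (weightedDensity bwd h₀ (fun _ _ => 1) τ) := by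
  obtain ⟨r, hr⟩ := exists_isPhaseDensity_transported hΦ h0
  rw [toL2_source_eq_kineticIntegral (hr τ).1 hφ, weightedDensity_one]

lemma transportedDensity_zero (hΦ : PhaseFlow T e fwd bwd) (x v : R3) :
    transportedDensity bwd h₀ 0 x v = h₀ (x, v) := by
  have := hΦ.bwd_fwd 0 (x, v)
  rw [hΦ.fwd_zero] at this
  rw [transportedDensity, this]

/-- The decomposition of the oscillatory part of the field, for a Borel measurable initial
density. -/
theorem spacetimeConv_source_eq (hΦ : PhaseFlow T e fwd bwd) (h0 : IsInitialDensity R h₀)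
    (hφ : ContDiff ℝ 1 φ) (σ : ℤˣ) {t : ℝ} (ht : t ∈ Icc 0 T) :
    spacetimeConv σ
        (fun τ => toL2 fun x => ((source φ (transportedDensity bwd h₀ τ) x : ℝ) : ℂ)) t
      = kerConv (GSymb σ t) (sourcePhi σ φ (transportedDensity bwd h₀ 0))
        - kerConv (aSymb σ) (sourcePhi σ φ (transportedDensity bwd h₀ t))
        + spacetimeConv σ
          (fun τ => sourceQuad σ φ (e τ) (transportedDensity bwd h₀ τ)) t := by
  obtain ⟨C, hC⟩ := hΦ.exists_norm_field_le
  have hfield := hΦ.continuous_field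
  have ha : ∀ j : Fin 3, Continuous fun p : ℝ × R3 => e p.1 p.2 j := fun j => by fun_prop
  have hA : ∀ (j : Fin 3) τ x, |e τ x j| ≤ C := fun j τ x =>
    (PiLp.norm_apply_le (e τ x) j).trans (hC τ x)
  have h1 : ∀ (τ : ℝ) (x : R3), |(fun (_ : ℝ) (_ : R3) => (1 : ℝ)) τ x| ≤ 1 := fun _ _ => by simp
  have hm := isVelocitySymbol_phiSymb_mul σ hφ.continuous
  have hw := isVelocitySymbol_weight hφ.continuous
  have hd := isVelocitySymbol_gradPhiSymb σ hφ
  refine eq_of_fourierPairing_eq fun χ hχ hχs => ?_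
  rw [(spacetimeConv_sourceQuad_eq_sum hΦ h0 hφ σ t).2, map_add, map_sub, map_sum]
  simp only [toL2_source_transported hΦ h0 hφ.continuous, sourcePhi_eq_kineticIntegral,
    ← weightedDensity_one]
  have eS := fourierPairing_duhamel hΦ h0 (a := fun _ _ => 1) continuous_const h1 hw σ ht.1 hχ hχs
  have eQ := fun j => fourierPairing_duhamel hΦ h0 (ha j) (hA j) (hd j) σ ht.1 hχ hχs
  have iQ := fun j => integrable_intervalIntegral_testField hΦ h0 (ha j) (hA j) (hd j) σ ht.1
    hχ hχs
  -- the boundary terms are the values of the Duhamel kernel at the two ends of the time interval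
  have e0 := fourierPairing_kerConv_eq_integral_fwd hΦ h0 (a := fun _ _ => 1) continuous_const h1
    hm σ t 0 hχ hχs
  have e1 := fourierPairing_kerConv_eq_integral_fwd hΦ h0 (a := fun _ _ => 1) continuous_const h1
    hm σ t t hχ hχs
  have i0 := integrable_testField_fwd hΦ h0 (a := fun _ _ => 1) continuous_const h1 hm σ t 0 hχ hχs
  have i1 := integrable_testField_fwd hΦ h0 (a := fun _ _ => 1) continuous_const h1 hm σ t t hχ hχs
  rw [sub_zero] at e0
  rw [sub_self, GSymb_zero] at e1
  simp only [Complex.ofReal_one, mul_one] at eS e0 e1 i0 i1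
  rw [eS, e0, e1]
  simp only [eQ]
  have i01 := i0.sub i1
  have iQ' := integrable_finsetSum Finset.univ fun j _ => iQ j
  simp only [Pi.sub_def] at i01
  rw [← integral_sub i0 i1, ← integral_finsetSum _ fun j _ => iQ j,
    ← integral_add i01 iQ']
  refine integral_congr_ae (Filter.Eventually.of_forall fun z => ?_)
  have key := testField_sub_testField hΦ hφ σ ht z hχ hχs
  beta_reduce
  rw [← Finset.sum_mul]
  linear_combination (h₀ z : ℂ) * key

end Decomposition

/-! ### Borel measurable representatives of the initial density -/

/-- A square integrable density that vanishes for large velocities has a Borel measurable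
representative that vanishes for large velocities, everywhere. -/
lemma exists_isInitialDensity_ae_eq {f₀ : R3 → R3 → ℝ} {R : ℝ}
    (hf₀ : MemLp (fun p : R3 × R3 => f₀ p.1 p.2) 2 (volume : Measure (R3 × R3)))
    (hR : ∀ x v, R < ‖v‖ → f₀ x v = 0) :
    ∃ h₀, IsInitialDensity R h₀ ∧ ∀ᵐ p : R3 × R3, f₀ p.1 p.2 = h₀ p := by
  have hQ : MeasurableSet {p : R3 × R3 | ‖p.2‖ ≤ R} :=
    (isClosed_le (by fun_prop) continuous_const).measurableSet
  have hae : ∀ᵐ p : R3 × R3,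
      f₀ p.1 p.2 = {p : R3 × R3 | ‖p.2‖ ≤ R}.indicator (hf₀.1.mk _) p := by
    filter_upwards [hf₀.1.ae_eq_mk] with p hp
    by_cases hpQ : p ∈ {p : R3 × R3 | ‖p.2‖ ≤ R}
    · rw [indicator_of_mem hpQ, ← hp]
    · rw [indicator_of_notMem hpQ, hR _ _ (not_le.1 hpQ)]
  refine ⟨_, ⟨hf₀.1.stronglyMeasurable_mk.indicator hQ, hf₀.ae_eq hae, fun z hz => ?_⟩, hae⟩
  exact indicator_of_notMem (s := {p : R3 × R3 | ‖p.2‖ ≤ R}) (not_le.2 hz) _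

lemma integrable_sourcePhiIntegrand {r : ℝ} {g : R3 → R3 → ℝ}
    (hg : IsPhaseDensity r fun x v => (g x v : ℂ)) {φ : R3 → ℝ} (hφ : Continuous φ) (σ : ℤˣ) :
    Integrable (sourcePhiIntegrand σ φ g) :=
  (integrable_kerConv_toL2 (isVelocitySymbol_phiSymb_mul σ hφ) hg).congr
    (Filter.Eventually.of_forall fun v => (sourcePhiIntegrand_eq σ g v).symm)

end VKG

theorem proposition5p4 (σ : ℤˣ) (T : ℝ)
    -- the electric field
    (E : ℝ → R3 → R3)
    (hEcont : ContinuousOn (fun p : ℝ × R3 => E p.1 p.2) (Icc 0 T ×ˢ univ))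
    (hEbdd : ∃ C : ℝ, ∀ t ∈ Icc 0 T, ∀ x, ‖E t x‖ ≤ C)
    (hElip : ∃ K : ℝ≥0, ∀ t ∈ Icc 0 T, LipschitzWith K (E t))
    -- its characteristics
    (X V : ℝ → ℝ → R3 → R3 → R3) (hXV : IsCharacteristics T E X V)
    -- the initial density, compactly supported in velocity
    (f₀ : R3 → R3 → ℝ)
    (hf₀ : MemLp (fun p : R3 × R3 => f₀ p.1 p.2) 2 (volume : Measure (R3 × R3)))
    (hsupp : ∃ R : ℝ, ∀ x v, R < ‖v‖ → f₀ x v = 0)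
    -- the velocity weight
    (φ : R3 → ℝ) (hφ : ContDiff ℝ 1 φ) :
    let f : ℝ → R3 → R3 → ℝ := transported f₀ X V
    let S : ℝ → L2x := fun t => toL2 fun x => ((source φ (f t) x : ℝ) : ℂ)
    let S0 : L2x := sourcePhi σ φ f₀
    let S1 : ℝ → L2x := fun t => sourcePhi σ φ (f t)
    let S2 : ℝ → L2x := fun t => sourceQuad σ φ (E t) (f t)
    -- all the terms are well defined
    (∀ t ∈ Icc 0 T,
      (∀ᵐ x : R3, Integrable fun v => f t x v * φ v) ∧
      MemLp (fun x => ((source φ (f t) x : ℝ) : ℂ)) 2 (volume : Measure R3) ∧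
      (∀ᵐ v : R3, MemLp (fun x => (f t x v : ℂ)) 2 (volume : Measure R3) ∧
        ∀ j : Fin 3, MemLp (fun x => ((E t x j * f t x v : ℝ) : ℂ)) 2 (volume : Measure R3)) ∧
      Integrable (sourcePhiIntegrand σ φ (f t)) ∧
      Integrable (sourceQuadIntegrand σ φ (E t) (f t)) ∧
      IntervalIntegrable (fun τ => kerConv (GSymb σ (t - τ)) (S τ)) volume 0 t ∧
      IntervalIntegrable (fun τ => kerConv (GSymb σ (t - τ)) (S2 τ)) volume 0 t) ∧
    Integrable (sourcePhiIntegrand σ φ f₀) ∧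
    -- the decomposition
    ∀ t ∈ Icc 0 T,
      spacetimeConv σ S t =
        kerConv (GSymb σ t) S0 - kerConv (aSymb σ) (S1 t) + spacetimeConv σ S2 t := by
  intro f S S0 S1 S2
  obtain ⟨C, hC⟩ := hEbdd
  obtain ⟨K, hK⟩ := hElip
  obtain ⟨R, hR⟩ := hsupp
  obtain ⟨h₀, h0, hae⟩ := exists_isInitialDensity_ae_eq hf₀ hR
  have hdens0 : IsPhaseDensity R fun x v => ((h₀ (x, v) : ℝ) : ℂ) :=
    ⟨Complex.continuous_ofReal.comp_stronglyMeasurable h0.stronglyMeasurable, h0.memLp.ofReal,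
      fun x v hv => by simp only [h0.eq_zero (x, v) hv, Complex.ofReal_zero]⟩
  have hφc := hφ.continuous
  have hS0 := sourcePhiIntegrand_congr (f' := fun x v => h₀ (x, v)) σ φ hae
  rw [and_left_comm, ← forall₂_and]
  refine ⟨(integrable_sourcePhiIntegrand hdens0 hφc σ).congr hS0.symm, fun t ht => ?_⟩
  have hT : 0 ≤ T := ht.1.trans ht.2
  have hΦ := hXV.phaseFlow hEcont hC hK hT
  set e : ℝ → R3 → R3 := fun τ => E (projIcc 0 T hT τ)
  set bwd : ℝ → R3 × R3 → R3 × R3 := fun τ => flow X V 0 (projIcc 0 T hT τ)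
  have hproj : ∀ τ ∈ Icc 0 T, (projIcc 0 T hT τ : ℝ) = τ := fun τ hτ => by
    rw [projIcc_of_mem hT hτ]
  have he : ∀ τ ∈ Icc 0 T, e τ = E τ := fun τ hτ => by simp only [e, hproj τ hτ]
  -- the flow preserves null sets, so that the choice of representative does not matter at any time
  have hf : ∀ τ ∈ Icc 0 T, ∀ᵐ p : R3 × R3,
      f τ p.1 p.2 = transportedDensity bwd h₀ τ p.1 p.2 := fun τ hτ => by
    filter_upwards [(hΦ.measurePreserving_bwd τ).quasiMeasurePreserving.ae hae] with p hp
    simpa only [f, transported, transportedDensity, bwd, flow, hproj τ hτ, Prod.mk.eta]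
      using hp
  have hS : ∀ τ ∈ Icc 0 T,
      S τ = toL2 fun x => ((source φ (transportedDensity bwd h₀ τ) x : ℝ) : ℂ) := fun τ hτ =>
    toL2_congr ((source_congr φ (hf τ hτ)).mono fun x hx => by simp only [hx])
  have hS1 : ∀ τ ∈ Icc 0 T, S1 τ = sourcePhi σ φ (transportedDensity bwd h₀ τ) := fun τ hτ =>
    integral_congr_ae (sourcePhiIntegrand_congr σ φ (hf τ hτ))
  have hS2 : ∀ τ ∈ Icc 0 T, S2 τ = sourceQuad σ φ (e τ) (transportedDensity bwd h₀ τ) :=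
    fun τ hτ => by
      rw [he τ hτ]
      exact integral_congr_ae (sourceQuadIntegrand_congr σ φ (E τ) (hf τ hτ))
  have huI : ∀ τ ∈ uIcc 0 t, τ ∈ Icc 0 T := fun τ hτ => by
    rw [uIcc_of_le ht.1] at hτ
    exact ⟨hτ.1, hτ.2.trans ht.2⟩
  have huIoc : ∀ τ ∈ uIoc 0 t, τ ∈ Icc 0 T := fun τ hτ => huI τ (uIoc_subset_uIcc hτ)
  obtain ⟨r, hr⟩ := exists_isPhaseDensity_transported hΦ h0
  have hquad := sourceQuad_eq_sum hΦ h0 hφ σ t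
  rw [he t ht] at hquad
  refine ⟨⟨?_, ?_, ?_, ?_, ?_, ?_, ?_⟩, ?_⟩
  · filter_upwards [ae_integrable_mul_weight (hr t).1 hφc,
      Measure.ae_ae_of_ae_prod (hf t ht)] with x hx1 hx2
    exact hx1.congr (hx2.mono fun v hv => by simp only [hv])
  · exact (memLp_source (hr t).1 hφc).ae_eq
      ((source_congr φ (hf t ht)).mono fun x hx => by simp only [hx])
  · filter_upwards [ae_slice_eq (hf t ht), (hr t).1.memLp_slice,
      ae_all_iff.2 fun j => ((hr t).2 j).memLp_slice] with v hv h1 h2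
    refine ⟨h1.ae_eq (hv.mono fun x hx => by simp only [hx]), fun j => (h2 j).ae_eq
      (hv.mono fun x hx => ?_)⟩
    simp only [weightedDensity, he t ht, hx, transportedDensity]
  · exact (integrable_sourcePhiIntegrand (hr t).1 hφc σ).congr
      (sourcePhiIntegrand_congr σ φ (hf t ht)).symm
  · exact hquad.1.congr (sourceQuadIntegrand_congr σ φ (E t) (hf t ht)).symm
  · refine (intervalIntegrable_kerConv_GSymb hΦ h0 (a := fun _ _ => 1) (A := 1) continuous_const
      (fun _ _ => by simp) (isVelocitySymbol_weight hφc) σ t).congr fun τ hτ => ?_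
    simp only [← toL2_source_transported hΦ h0 hφc, hS τ (huIoc τ hτ)]
  · refine (spacetimeConv_sourceQuad_eq_sum hΦ h0 hφ σ t).1.congr fun τ hτ => ?_
    simp only [hS2 τ (huIoc τ hτ)]
  · have hS0' : S0 = sourcePhi σ φ (transportedDensity bwd h₀ 0) := by
      have h : transportedDensity bwd h₀ 0 = fun x v => h₀ (x, v) := by
        ext x v
        exact transportedDensity_zero hΦ x v
      rw [h]
      exact integral_congr_ae hS0
    have hconv := spacetimeConv_source_eq hΦ h0 hφ σ ht
    rw [hS0', hS1 t ht]
    refine Eq.trans ?_ (hconv.trans ?_)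
    · exact intervalIntegral.integral_congr fun τ hτ => by simp only [hS τ (huI τ hτ)]
    · congr 1
      exact intervalIntegral.integral_congr fun τ hτ => by simp only [hS2 τ (huI τ hτ)]
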